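/- **Theorem 5.1 (Projectional coderivative chain rule).** *Notation.* All spaces carry the Euclidean norm and inner product, also the products $\mathbb R^n\times\mathbb R^m$. For a set $C$ and $x\in C$: $T_C(x)=\limsup_{t\searrow0}(C-x)/t$ is the tangent (contingent) cone; $\widehat N_C(x)$ is the set of all $v$ with $\langle v,y-x\rangle\le o(\|y-x\|)$ as $y\to x$ in $C$; $N_C(x)=\limsup_{y\to x,\,y\in C}\widehat N_C(y)$ is the limiting normal cone (all three are empty if $x\notin C$). Here $\limsup$ is the Painlevé–Kuratowski outer limit, i.e. the set of all limits of sequences $v_k\in M(z_k)$ with $z_k\to \bar z$ (inside the indicated set). For sets $C,A$, $\mathrm{proj}_C A$ is the set of all points of $C$ that are nearest in $C$ to some point of $A$. For a set-valued mapping $S:\mathbb R^n\rightrightarrows\mathbb R^m$, $\mathrm{gph}\,S=\{(x,u)\mid u\in S(x)\}$, $S^{-1}(u)=\{x\mid u\in S(x)\}$, $(S_2\circ S_1)(x)=\bigcup_{w\in S_1(x)}S_2(w)$, and $S|_X$ equals $S$ on $X$ and $\emptyset$ off $X$. $S$ is graph-convex if $\mathrm{gph}\,S$ is convex. $S$ is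 outer semicontinuous at $x\in X$ relative to $X$ if $\limsup_{y\to x,\,y\in X}S(y)=S(x)$, and outer semicontinuous relative to $X$ if this holds at every $x\in X$ ("relative to the whole space" is omitted). $S$ is locally bounded relative to $X$ at $x$ if $S(V\cap X)$ is bounded for some neighborhood $V$ of $x$. A set $C$ is locally closed at $x\in C$ if $C\cap U$ is closed for some closed neighborhood $U$ of $x$. The coderivative and the projectional coderivative are $$x^*\in D^*S(\bar x\mid\bar u)(u^*)\iff (x^*,-u^*)\in N_{\mathrm{gph}\,S}(\bar x,\bar u),$$ $$t^*\in D^*_XS(\bar x\mid\bar u)(u^*)\iff (t^*,-u^*)\in\limsup_{(x,u)\to(\bar x,\bar u),\ (x,u)\in\mathrm{gph}\,S|_X}\mathrm{proj}_{T_X(x)\times\mathbb R^m}N_{\mathrm{gph}\,S|_X}(x,u).$$ $S$ is Lipschitz-like at $\bar x$ for $\bar u\in S(\bar x)$ if $\mathrm{gph}\,S$ is locally closed at $(\bar x,\bar u)$ and there are neighborhoods $V$ of $\bar x$, $W$ of $\bar u$ and $\kappa\ge0$ such that $S(x')\cap W\subset S(x)+\kappa\|x'-x\|\mathbb B$ for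 all $x,x'\in V$, where $\mathbb B$ is the closed unit ball. $X$ is a ($d$-dimensional) smooth manifold around $\bar x\in X$ if there are an open neighborhood $O$ of $\bar x$ and a $C^1$ mapping $F:O\to\mathbb R^{n-d}$, $0\le d\le n$, with $X\cap O=\{x\in O\mid F(x)=0\}$ and $\nabla F(\bar x)$ of full rank $n-d$. *Statement.* Let $S=S_2\circ S_1$ with $S_1:\mathbb R^n\rightrightarrows\mathbb R^p$ and $S_2:\mathbb R^p\rightrightarrows\mathbb R^m$, let $X\subseteq\mathbb R^n$ be closed, $\bar x\in X$ and $\bar u\in S(\bar x)$. Let $S_1$ be outer semicontinuous relative to $X$ and $S_2$ outer semicontinuous. Consider the conditions (a) the mapping $(x,u)\mapsto S_1|_X(x)\cap S_2^{-1}(u)$ is locally bounded at $(\bar x,\bar u)$; (b) $D^*S_2(\bar w\mid\bar u)(0)\cap D^*_XS_1(\bar x\mid\bar w)^{-1}(0)=\{0\}$ for every $\bar w\in S_1|_X(\bar x)\cap S_2^{-1}(\bar u)$. 1. If (a) and (b) hold, then $\mathrm{gph}\,S|_X$ is locally closed at $(\bar x,\bar u)$ and, for every $u^*\in\mathbb R^m$,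 $$D^*_XS(\bar x\mid\bar u)(u^*)\subset\bigcup_{\bar w\in S_1|_X(\bar x)\cap S_2^{-1}(\bar u)}\bigl(D^*_XS_1(\bar x\mid\bar w)\circ D^*S_2(\bar w\mid\bar u)\bigr)(u^*).$$ If in addition $S_1|_X$ and $S_2$ are graph-convex and $X$ is a smooth manifold around $\bar x$ (of some dimension), then $S|_X$ is graph-convex and $$D^*_XS(\bar x\mid\bar u)=D^*_XS_1(\bar x\mid\bar w)\circ D^*S_2(\bar w\mid\bar u)\quad\text{for every }\bar w\in S_1|_X(\bar x)\cap S_2^{-1}(\bar u).$$ 2. (a) is equivalent to local boundedness of $(x,u)\mapsto S_1(x)\cap S_2^{-1}(u)$ relative to $X\times\mathbb R^m$ at $(\bar x,\bar u)$, and it holds if $S_1$ is locally bounded relative to $X$ at $\bar x$ or $S_2^{-1}$ is locally bounded at $\bar u$. If the mapping in (a) is locally bounded at $(\bar x,u)$ for every $u\in\mathbb R^m$, then $S_2\circ S_1|_X$ is outer semicontinuous at $\bar x$. 3. For each $\bar w\in S_1|_X(\bar x)\cap S_2^{-1}(\bar u)$, the equality in (b) holds if $S_2$ is Lipschitz-like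 at $\bar w$ for $\bar u$. -/

import Mathlib

open Filter Topology Set

namespace ProjCoderiv

/-! ### Set-valued mappings

A set-valued mapping `S : α ⇉ β` is a function `S : α → Set β`. -/

section Maps

variable {α β γ : Type*}

/-- The restricted mapping `S|_X`: equal to `S x` for `x ∈ X` and empty otherwise. -/
def restrictMap (S : α → Set β) (X : Set α) : α → Set β :=
  fun x => {u | x ∈ X ∧ u ∈ S x}

/-- The inverse mapping `S⁻¹(u) = {x | u ∈ S(x)}`. -/
def invMap (S : α → Set β) : β → Set α :=
  fun u => {x | u ∈ S x}

/-- The composition `(S₂ ∘ S₁)(x) = ⋃_{w ∈ S₁(x)} S₂(w)`. -/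
def compMap (S₂ : β → Set γ) (S₁ : α → Set β) : α → Set γ :=
  fun x => ⋃ w ∈ S₁ x, S₂ w

end Maps

section Limits

variable {α β : Type*} [TopologicalSpace β]

/-- The Painlevé–Kuratowski outer limit of the sets `M z` as `z` tends to the filter `l`: all
limits of sequences `v k ∈ M (z k)` with `z k → l`. For `z → z₀` inside a set `A`, the filter is
`𝓝[A] z₀`. -/
def outerLimit (l : Filter α) (M : α → Set β) : Set β :=
  {v₀ | ∃ (z : ℕ → α) (v : ℕ → β),
    Tendsto z atTop l ∧ (∀ k, v k ∈ M (z k)) ∧ Tendsto v atTop (𝓝 v₀)}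

/-- `S` is outer semicontinuous at `x` relative to `X`. -/
def OuterSemicontinuousAtRel [TopologicalSpace α] (S : α → Set β) (X : Set α) (x : α) : Prop :=
  x ∈ X ∧ outerLimit (𝓝[X] x) S = S x

/-- `S` is outer semicontinuous relative to `X`, that is, at every point of `X`. -/
def OuterSemicontinuousRel [TopologicalSpace α] (S : α → Set β) (X : Set α) : Prop :=
  ∀ x ∈ X, OuterSemicontinuousAtRel S X x

/-- `S` is locally bounded relative to `X` at `x`: the image `S(V ∩ X)` is bounded for some
neighborhood `V` of `x`. Plain local boundedness is the case `X = univ`. -/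
def LocallyBoundedRel {F : Type*} [Bornology F] [TopologicalSpace α]
    (S : α → Set F) (X : Set α) (x : α) : Prop :=
  ∃ V ∈ 𝓝 x, Bornology.IsBounded (⋃ y ∈ V ∩ X, S y)

/-- `C` is locally closed at `x`: `C ∩ U` is closed for some closed neighborhood `U` of `x`. -/
def LocallyClosedAt (C : Set β) (x : β) : Prop :=
  ∃ U ∈ 𝓝 x, IsClosed U ∧ IsClosed (C ∩ U)

end Limits

/-! ### Tangent cones, normal cones and projections -/

section Cones

variable {H : Type*} [NormedAddCommGroup H] [InnerProductSpace ℝ H]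

/-- The tangent (contingent) cone `T_C(x) = limsup_{t ↘ 0} (C - x) / t`, empty if `x ∉ C`. -/
def tangentCone (C : Set H) (x : H) : Set H :=
  {w | x ∈ C ∧ w ∈ outerLimit (𝓝[>] (0 : ℝ)) (fun t => {d : H | x + t • d ∈ C})}

/-- The regular (Fréchet) normal cone: `⟪v, y - x⟫ ≤ o(‖y - x‖)` for `y → x` in `C`;
empty if `x ∉ C`. -/
def regularNormalCone (C : Set H) (x : H) : Set H :=
  {v | x ∈ C ∧ ∀ ε : ℝ, 0 < ε → ∀ᶠ y in 𝓝[C] x, inner ℝ v (y - x) ≤ ε * ‖y - x‖}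

/-- The limiting (Mordukhovich) normal cone, empty if `x ∉ C`. -/
def normalCone (C : Set H) (x : H) : Set H :=
  {v | x ∈ C ∧ v ∈ outerLimit (𝓝[C] x) (regularNormalCone C)}

/-- The projection `proj_C(A)` of a set `A` onto `C`: all points of `C` that are nearest in `C` to
some point of `A`. -/
def projSet (C A : Set H) : Set H :=
  {y | y ∈ C ∧ ∃ a ∈ A, ‖y - a‖ = Metric.infDist a C}

end Cones

/-! ### Coderivatives -/

section Coderivatives

variable {E F : Type*} [NormedAddCommGroup E] [InnerProductSpace ℝ E]
  [NormedAddCommGroup F] [InnerProductSpace ℝ F]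

/-- The graph of `S`, in the product with its Euclidean (`ℓ²`) structure. -/
def gph (S : E → Set F) : Set (WithLp 2 (E × F)) :=
  {z | z.snd ∈ S z.fst}

/-- `S` is graph-convex: its graph is a convex set. -/
def GraphConvex (S : E → Set F) : Prop :=
  Convex ℝ (gph S)

/-- The coderivative `D*S(x | u)`: `x* ∈ D*S(x | u)(u*)` iff `(x*, -u*) ∈ N_{gph S}(x, u)`. -/
def coderivative (S : E → Set F) (x : E) (u : F) : F → Set E :=
  fun u' => {x' | WithLp.toLp 2 (x', -u') ∈ normalCone (gph S) (WithLp.toLp 2 (x, u))}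

/-- The projectional coderivative `D*_X S(x | u)`: `t* ∈ D*_X S(x | u)(u*)` iff `(t*, -u*)` lies in
the outer limit of `proj_{T_X(x') × F} N_{gph S|_X}(x', u')` as `(x', u') → (x, u)` in
`gph S|_X`. -/
def projCoderivative (X : Set E) (S : E → Set F) (x : E) (u : F) : F → Set E :=
  fun u' => {t | WithLp.toLp 2 (t, -u') ∈
    outerLimit (𝓝[gph (restrictMap S X)] (WithLp.toLp 2 (x, u)))
      (fun z => projSet {y : WithLp 2 (E × F) | y.fst ∈ tangentCone X z.fst}
        (normalCone (gph (restrictMap S X)) z))}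

/-- The Lipschitz-like (Aubin) property of `S` relative to `X` at `x` for `u`. The Lipschitz-like
property is the case `X = univ`. -/
def LipschitzLikeRel (S : E → Set F) (X : Set E) (x : E) (u : F) : Prop :=
  x ∈ X ∧ u ∈ S x ∧ LocallyClosedAt (gph S) (WithLp.toLp 2 (x, u)) ∧
    ∃ V ∈ 𝓝 x, ∃ W ∈ 𝓝 u, ∃ κ : ℝ, 0 ≤ κ ∧
      ∀ y ∈ X ∩ V, ∀ y' ∈ X ∩ V, ∀ v' ∈ S y' ∩ W, ∃ v ∈ S y, ‖v' - v‖ ≤ κ * ‖y' - y‖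

end Coderivatives

/-- `X ⊆ ℝⁿ` is a (`C¹`-)smooth manifold of dimension `d` around the point `x ∈ X`: on an open
neighborhood `O` of `x` it is the solution set of `F = 0`, where `F : O → ℝⁿ⁻ᵈ` is `C¹` and
its derivative at `x` has full rank `n - d`. -/
def IsSmoothManifoldAround {n : ℕ} (d : ℕ) (X : Set (EuclideanSpace ℝ (Fin n)))
    (x : EuclideanSpace ℝ (Fin n)) : Prop :=
  x ∈ X ∧ d ≤ n ∧ ∃ O : Set (EuclideanSpace ℝ (Fin n)), IsOpen O ∧ x ∈ O ∧
    ∃ F : EuclideanSpace ℝ (Fin n) → EuclideanSpace ℝ (Fin (n - d)),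
      ContDiffOn ℝ 1 F O ∧ Function.Surjective (fderiv ℝ F x) ∧
      X ∩ O = {y ∈ O | F y = 0}

end ProjCoderiv

open ProjCoderiv

namespace ProjCoderiv

/-! Write `T` for the restriction of `S₁` to `X`. The core is a penalty argument
(`fuzzy_chain_rule_regular`). For a regular normal `(v, y)` to the graph of the composition,
decouple the intermediate point into two copies and minimize the squared distance to `(x₀ + t v, u₀
+ t y)` plus `k` times the squared gap of the copies. Feasible intermediate points are bounded, so
minimizers exist in a box and cluster at a feasible point, which the normal inequality keeps near
the reference. Optimality in each block gives normals `(v', q)` and `(-q, y')` to the two graphs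
with a shared `q`.

Nothing bounds `q`, so passage to the limit normalizes by `l + ‖q‖ = 1`
(`exists_multiplier_of_mem_normalCone_compMap`). This is done at each graph point with `x` fixed:
both projections then use the same tangent cone, and projection onto a cone commutes with scaling by
`l`. In the outer limit, `l = 0` would give a nonzero element of the intersection in (b); otherwise
division by `l` gives the inclusion.

In the graph-convex case, tangent cones near `x₀` are kernels of a continuous family of linear maps
and contain all directions into the graph. Projection therefore leaves the normal inequality intact
(`mem_projCoderivative_iff_of_graphConvex`). Adding such inequalities gives the reverse inclusion,
and testing them against each other shows that all intermediate points are interchangeable. The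
Lipschitz criterion comes from `‖x*‖ ≤ κ ‖u*‖` for nearby regular normals. -/

theorem mem_outerLimit_nhdsWithin {α β : Type*} [PseudoMetricSpace α] [PseudoMetricSpace β]
    {M : α → Set β} {A : Set α} {x : α} {v : β} :
    v ∈ outerLimit (𝓝[A] x) M ↔
      ∀ ε : ℝ, 0 < ε → ∃ z ∈ A, ∃ w ∈ M z, dist z x < ε ∧ dist w v < ε := by
  constructor
  · rintro ⟨z, w, hz, hw, hv⟩ ε hε
    rw [tendsto_nhdsWithin_iff] at hz
    obtain ⟨k, h₁, h₂, h₃⟩ := ((hz.1.eventually (Metric.ball_mem_nhds x hε)).and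
      (hz.2.and (hv.eventually (Metric.ball_mem_nhds v hε)))).exists
    exact ⟨z k, h₂, w k, hw k, h₁, h₃⟩
  · intro h
    choose z hzA w hw hz hv using fun k : ℕ => h (1 / ((k : ℝ) + 1)) Nat.one_div_pos_of_nat
    have h0 := tendsto_one_div_add_atTop_nhds_zero_nat (𝕜 := ℝ)
    refine ⟨z, w, tendsto_nhdsWithin_iff.2 ⟨?_, .of_forall hzA⟩, hw, ?_⟩
    · exact tendsto_iff_dist_tendsto_zero.2
        (squeeze_zero (fun _ => dist_nonneg) (fun k => (hz k).le) h0)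
    · exact tendsto_iff_dist_tendsto_zero.2
        (squeeze_zero (fun _ => dist_nonneg) (fun k => (hv k).le) h0)

theorem smul_mem_outerLimit {α β : Type*} [TopologicalSpace β] [SMul ℝ β] [ContinuousConstSMul ℝ β]
    {l : Filter α} {M : α → Set β} {c : ℝ} (hM : ∀ z, ∀ v ∈ M z, c • v ∈ M z) {v : β}
    (hv : v ∈ outerLimit l M) : c • v ∈ outerLimit l M := by
  obtain ⟨z, w, hz, hw, h⟩ := hv
  exact ⟨z, fun k => c • w k, hz, fun k => hM _ _ (hw k), h.const_smul c⟩

theorem subset_outerLimit_nhdsWithin {α β : Type*} [TopologicalSpace α] [TopologicalSpace β]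
    (M : α → Set β) {A : Set α} {x : α} (hx : x ∈ A) : M x ⊆ outerLimit (𝓝[A] x) M :=
  fun v hv => ⟨fun _ => x, fun _ => v,
    tendsto_nhdsWithin_iff.2 ⟨tendsto_const_nhds, .of_forall fun _ => hx⟩,
    fun _ => hv, tendsto_const_nhds⟩

/-! ### Elementary properties of normal and tangent cones. -/

section Cones

variable {H : Type*} [NormedAddCommGroup H] [InnerProductSpace ℝ H]

theorem smul_mem_regularNormalCone {C : Set H} {x v : H} {c : ℝ} (hc : 0 ≤ c)
    (hv : v ∈ regularNormalCone C x) : c • v ∈ regularNormalCone C x := by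
  refine ⟨hv.1, fun ε hε => ?_⟩
  -- Dividing by `c + 1` instead of `c` also covers `c = 0`.
  filter_upwards [hv.2 (ε / (c + 1)) (by positivity)] with y hy
  rw [real_inner_smul_left]
  calc c * inner ℝ v (y - x) ≤ c * (ε / (c + 1) * ‖y - x‖) := by gcongr
    _ = (c / (c + 1)) * (ε * ‖y - x‖) := by ring
    _ ≤ 1 * (ε * ‖y - x‖) := by
        gcongr
        rw [div_le_one (by positivity)]
        linarith
    _ = _ := one_mul _

theorem smul_mem_normalCone {C : Set H} {x v : H} {c : ℝ} (hc : 0 ≤ c)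
    (hv : v ∈ normalCone C x) : c • v ∈ normalCone C x :=
  ⟨hv.1, smul_mem_outerLimit (fun _ _ h => smul_mem_regularNormalCone hc h) hv.2⟩

/-- A quadratic error is `o(‖y - x‖)`; this is the form in which optimality conditions deliver
normals. -/
theorem mem_regularNormalCone_of_quadratic_bound {C : Set H} {x v : H} (hx : x ∈ C) {σ : ℝ}
    (h : ∀ᶠ y in 𝓝[C] x, inner ℝ v (y - x) ≤ σ * ‖y - x‖ ^ 2) : v ∈ regularNormalCone C x := by
  refine ⟨hx, fun ε hε => ?_⟩
  have hlim : Tendsto (fun y => |σ| * ‖y - x‖) (𝓝[C] x) (𝓝 0) := by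
    have : Continuous fun y : H => |σ| * ‖y - x‖ := by fun_prop
    simpa using (this.tendsto x).mono_left nhdsWithin_le_nhds
  filter_upwards [h, hlim.eventually (gt_mem_nhds hε)] with y hy hyε
  calc inner ℝ v (y - x) ≤ σ * ‖y - x‖ ^ 2 := hy
    _ ≤ |σ| * ‖y - x‖ ^ 2 := by gcongr; exact le_abs_self σ
    _ = |σ| * ‖y - x‖ * ‖y - x‖ := by ring
    _ ≤ ε * ‖y - x‖ := by gcongr

theorem regularNormalCone_subset_normalCone (C : Set H) (x : H) :
    regularNormalCone C x ⊆ normalCone C x :=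
  fun _ hv => ⟨hv.1, subset_outerLimit_nhdsWithin _ hv.1 hv⟩

theorem zero_mem_normalCone {C : Set H} {x : H} (hx : x ∈ C) : (0 : H) ∈ normalCone C x :=
  regularNormalCone_subset_normalCone _ _
    (mem_regularNormalCone_of_quadratic_bound hx (σ := 0) (.of_forall fun y => by simp))

/-- The limiting normal cone mapping has a sequentially closed graph over `C`. -/
theorem mem_normalCone_of_tendsto {C : Set H} {x v : H} (hx : x ∈ C) {z w : ℕ → H}
    (hz : Tendsto z atTop (𝓝 x)) (hw : Tendsto w atTop (𝓝 v))
    (h : ∀ k, w k ∈ normalCone C (z k)) : v ∈ normalCone C x := by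
  refine ⟨hx, mem_outerLimit_nhdsWithin.2 fun ε hε => ?_⟩
  obtain ⟨k, h₁, h₂⟩ := ((hz.eventually (Metric.ball_mem_nhds x (half_pos hε))).and
    (hw.eventually (Metric.ball_mem_nhds v (half_pos hε)))).exists
  obtain ⟨y, hy, n, hn, h₃, h₄⟩ := mem_outerLimit_nhdsWithin.1 (h k).2 (ε / 2) (half_pos hε)
  exact ⟨y, hy, n, hn, by linarith [dist_triangle y (z k) x], by linarith [dist_triangle n (w k) v]⟩

/-- Limiting normals to a convex set are normals in the sense of convex analysis. -/
theorem mem_normalCone_iff_of_convex {C : Set H} (hC : Convex ℝ C) {x v : H} (hx : x ∈ C) :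
    v ∈ normalCone C x ↔ ∀ y ∈ C, inner ℝ v (y - x) ≤ 0 := by
  -- Convexity keeps the segment from `x` to `y` in `C`; testing the regular normal along it and
  -- dividing by `t` removes the locality.
  have hreg : ∀ {x v : H}, v ∈ regularNormalCone C x → ∀ y ∈ C, inner ℝ v (y - x) ≤ 0 := by
    intro x v hv y hy
    have hlim : Tendsto (fun t : ℝ => x + t • (y - x)) (𝓝[>] 0) (𝓝[C] x) := by
      refine tendsto_nhdsWithin_iff.2 ⟨?_, ?_⟩
      · have : Continuous fun t : ℝ => x + t • (y - x) := by fun_prop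
        simpa using (this.tendsto 0).mono_left nhdsWithin_le_nhds
      · filter_upwards [Ioo_mem_nhdsGT (zero_lt_one' ℝ)] with t ht
        exact hC.add_smul_sub_mem hv.1 hy ⟨ht.1.le, ht.2.le⟩
    refine le_of_forall_pos_le_add fun ε hε => ?_
    have hpos : 0 < ‖y - x‖ + 1 := by positivity
    obtain ⟨t, ht, ht0⟩ := ((hlim.eventually (hv.2 (ε / (‖y - x‖ + 1)) (by positivity))).and
      self_mem_nhdsWithin).exists
    have ht0 : 0 < t := ht0
    rw [add_sub_cancel_left, real_inner_smul_right, norm_smul, Real.norm_of_nonneg ht0.le] at ht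
    have h1 : inner ℝ v (y - x) ≤ ε / (‖y - x‖ + 1) * ‖y - x‖ := by
      refine le_of_mul_le_mul_left ?_ ht0
      linarith
    have h2 : ε / (‖y - x‖ + 1) * ‖y - x‖ ≤ ε := by
      rw [div_mul_eq_mul_div, div_le_iff₀ hpos]
      nlinarith
    linarith
  constructor
  · rintro ⟨-, z, w, hz, hw, h⟩ y hy
    have hlim : Tendsto (fun k => inner ℝ (w k) (y - z k)) atTop (𝓝 (inner ℝ v (y - x))) :=
      h.inner (tendsto_const_nhds.sub (tendsto_nhdsWithin_iff.1 hz).1)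
    exact le_of_tendsto hlim (.of_forall fun k => hreg (hw k) y hy)
  · intro h
    refine regularNormalCone_subset_normalCone _ _
      (mem_regularNormalCone_of_quadratic_bound hx (σ := 0) ?_)
    filter_upwards [self_mem_nhdsWithin] with y hy
    simpa using h y hy

theorem zero_mem_tangentCone {C : Set H} {x : H} (hx : x ∈ C) : (0 : H) ∈ tangentCone C x := by
  refine ⟨hx, fun k => 1 / ((k : ℝ) + 1), fun _ => 0, ?_, fun k => by simpa using hx,
    tendsto_const_nhds⟩
  exact tendsto_nhdsWithin_iff.2 ⟨tendsto_one_div_add_atTop_nhds_zero_nat,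
    .of_forall fun k => mem_Ioi.2 (Nat.one_div_pos_of_nat (n := k))⟩

theorem smul_mem_tangentCone {C : Set H} {x w : H} {c : ℝ} (hc : 0 ≤ c)
    (hw : w ∈ tangentCone C x) : c • w ∈ tangentCone C x := by
  rcases hc.eq_or_lt with rfl | hc
  · simpa using zero_mem_tangentCone hw.1
  obtain ⟨hx, t, d, ht, hd, hlim⟩ := hw
  rw [tendsto_nhdsWithin_iff] at ht
  -- The point `x + t • d` is unchanged when the step is divided by `c` and the direction multiplied
  -- by `c`.
  refine ⟨hx, fun k => c⁻¹ * t k, fun k => c • d k, ?_, fun k => ?_, hlim.const_smul c⟩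
  · refine tendsto_nhdsWithin_iff.2 ⟨by simpa using ht.1.const_mul c⁻¹, ?_⟩
    filter_upwards [ht.2] with k hk
    exact mul_pos (inv_pos.2 hc) hk
  · have := hd k
    simp only [mem_ofPred_eq, smul_smul] at this ⊢
    rwa [show c⁻¹ * t k * c = t k by field_simp]

end Cones

/-! ### Projections in Euclidean products. -/

section NormedProduct

variable {E F : Type*} [NormedAddCommGroup E] [NormedAddCommGroup F]

theorem norm_le_norm_fst_add_norm_snd (z : WithLp 2 (E × F)) : ‖z‖ ≤ ‖z.fst‖ + ‖z.snd‖ := by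
  refine abs_le_of_sq_le_sq' ?_ (by positivity) |>.2
  rw [WithLp.prod_norm_sq_eq_of_L2]
  nlinarith [norm_nonneg z.fst, norm_nonneg z.snd]

/-- The projection onto `T × F` acts on the first components only. -/
theorem mem_projSet_fst_iff {T : Set E} {A : Set (WithLp 2 (E × F))} {t : E} {y : F} :
    WithLp.toLp 2 (t, y) ∈ projSet {z : WithLp 2 (E × F) | z.fst ∈ T} A ↔
      ∃ v, WithLp.toLp 2 (v, y) ∈ A ∧ t ∈ T ∧ ∀ s ∈ T, ‖t - v‖ ≤ ‖s - v‖ := by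
  constructor
  · rintro ⟨ht, a, ha, hdist⟩
    have hle : ∀ s ∈ T, ∀ u, ‖WithLp.toLp 2 (t, y) - a‖ ≤ ‖WithLp.toLp 2 (s, u) - a‖ := by
      intro s hs u
      rw [hdist, ← dist_eq_norm, dist_comm]
      exact Metric.infDist_le_dist_of_mem hs
    have hsq : ∀ s ∈ T, ∀ u, ‖t - a.fst‖ ^ 2 + ‖y - a.snd‖ ^ 2 ≤
        ‖s - a.fst‖ ^ 2 + ‖u - a.snd‖ ^ 2 := by
      intro s hs u
      have := pow_le_pow_left₀ (norm_nonneg _) (hle s hs u) 2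
      simpa [WithLp.prod_norm_sq_eq_of_L2] using this
    -- The second component is unconstrained, so `a.snd` is a competitor there.
    have hy : y = a.snd := by
      have := hsq t ht a.snd
      have h0 : ‖y - a.snd‖ ^ 2 ≤ 0 := by simpa using this
      exact sub_eq_zero.1 (norm_eq_zero.1 (by nlinarith [norm_nonneg (y - a.snd)]))
    refine ⟨a.fst, hy ▸ ha, ht, fun s hs => ?_⟩
    have := hsq s hs y
    exact abs_le_of_sq_le_sq' (by linarith) (norm_nonneg _) |>.2
  · rintro ⟨v, hv, ht, hmin⟩
    refine ⟨ht, _, hv, le_antisymm ?_ ?_⟩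
    · refine (Metric.le_infDist ⟨WithLp.toLp 2 (t, y), ht⟩).2 fun b hb => ?_
      rw [dist_comm, dist_eq_norm]
      refine abs_le_of_sq_le_sq' ?_ (norm_nonneg _) |>.2
      have := pow_le_pow_left₀ (norm_nonneg _) (hmin _ hb) 2
      simp only [WithLp.prod_norm_sq_eq_of_L2, WithLp.sub_fst, WithLp.sub_snd, WithLp.toLp_fst,
        WithLp.toLp_snd, sub_self, norm_zero]
      nlinarith [norm_nonneg (b.snd - y)]
    · rw [← dist_eq_norm, dist_comm]
      exact Metric.infDist_le_dist_of_mem ht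

theorem mem_projSet_fst_of_mem {T : Set E} {A : Set (WithLp 2 (E × F))} {t : E} {y : F}
    (ht : t ∈ T) (hA : WithLp.toLp 2 (t, y) ∈ A) :
    WithLp.toLp 2 (t, y) ∈ projSet {z : WithLp 2 (E × F) | z.fst ∈ T} A :=
  mem_projSet_fst_iff.2 ⟨t, hA, ht, fun s _ => by simp⟩

end NormedProduct

/-! ### Positive homogeneity of the coderivatives. -/

section Product

variable {E F : Type*} [NormedAddCommGroup E] [InnerProductSpace ℝ E]
  [NormedAddCommGroup F] [InnerProductSpace ℝ F]

theorem inner_toLp_sub (v : E) (y : F) (z z' : WithLp 2 (E × F)) :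
    inner ℝ (WithLp.toLp 2 (v, y)) (z' - z) =
      inner ℝ v (z'.fst - z.fst) + inner ℝ y (z'.snd - z.snd) :=
  WithLp.prod_inner_apply _ _

/-- For `c > 0`, dilation by `c` permutes the cone and scales all distances equally. Convexity of
the cone plays no role. -/
theorem nearest_smul_tangentCone {X : Set E} {x t v : E} {c : ℝ} (hc : 0 ≤ c)
    (h : ∀ s ∈ tangentCone X x, ‖t - v‖ ≤ ‖s - v‖) :
    ∀ s ∈ tangentCone X x, ‖c • t - c • v‖ ≤ ‖s - c • v‖ := by
  intro s hs
  rcases hc.eq_or_lt with rfl | hc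
  · simp
  have h1 := h _ (smul_mem_tangentCone (inv_nonneg.2 hc.le) hs)
  rw [← smul_sub, norm_smul, Real.norm_of_nonneg hc.le]
  calc c * ‖t - v‖ ≤ c * ‖c⁻¹ • s - v‖ := by gcongr
    _ = ‖c • (c⁻¹ • s - v)‖ := by rw [norm_smul, Real.norm_of_nonneg hc.le]
    _ = ‖s - c • v‖ := by rw [smul_sub, smul_inv_smul₀ hc.ne']

theorem smul_mem_projCoderivative {X : Set E} {S : E → Set F} {x : E} {u : F} {t : E} {u' : F}
    {c : ℝ} (hc : 0 ≤ c) (h : t ∈ projCoderivative X S x u u') :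
    c • t ∈ projCoderivative X S x u (c • u') := by
  have hcone : ∀ z : WithLp 2 (E × F), ∀ v ∈ projSet {y : WithLp 2 (E × F) | y.fst ∈
      tangentCone X z.fst} (normalCone (gph (restrictMap S X)) z), c • v ∈ projSet
      {y : WithLp 2 (E × F) | y.fst ∈ tangentCone X z.fst} (normalCone (gph (restrictMap S X)) z) := by
    intro z v hv
    obtain ⟨w, hw, ht, hmin⟩ := mem_projSet_fst_iff.1 (show WithLp.toLp 2 (v.fst, v.snd) ∈ _ from hv)
    exact mem_projSet_fst_iff.2 ⟨c • w, smul_mem_normalCone hc hw, smul_mem_tangentCone hc ht,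
      nearest_smul_tangentCone hc hmin⟩
  have := smul_mem_outerLimit hcone (show WithLp.toLp 2 (t, -u') ∈ outerLimit _ _ from h)
  rwa [← WithLp.toLp_smul, Prod.smul_mk, smul_neg] at this

theorem zero_mem_projCoderivative {X : Set E} {S : E → Set F} {x : E} {u : F}
    (h : u ∈ restrictMap S X x) : (0 : E) ∈ projCoderivative X S x u 0 := by
  refine subset_outerLimit_nhdsWithin (fun z : WithLp 2 (E × F) => projSet
    {y : WithLp 2 (E × F) | y.fst ∈ tangentCone X z.fst} (normalCone (gph (restrictMap S X)) z))
    (show WithLp.toLp 2 (x, u) ∈ gph (restrictMap S X) from h)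
    (mem_projSet_fst_of_mem (zero_mem_tangentCone h.1) ?_)
  rw [neg_zero]
  exact zero_mem_normalCone (show WithLp.toLp 2 (x, u) ∈ gph (restrictMap S X) from h)

theorem smul_mem_coderivative {S : E → Set F} {x : E} {u : F} {t : E} {u' : F}
    {c : ℝ} (hc : 0 ≤ c) (h : t ∈ coderivative S x u u') :
    c • t ∈ coderivative S x u (c • u') := by
  have := smul_mem_normalCone hc h
  rwa [← WithLp.toLp_smul, Prod.smul_mk, smul_neg] at this

theorem zero_mem_coderivative {S : E → Set F} {x : E} {u : F}
    (h : u ∈ S x) : (0 : E) ∈ coderivative S x u 0 := by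
  have := zero_mem_normalCone (show WithLp.toLp 2 (x, u) ∈ gph S from h)
  rw [coderivative, mem_ofPred_eq, neg_zero]
  exact this

end Product

/-! ### Optimality conditions and compactness for the penalty problem. -/

section Penalty

variable {E F : Type*} [NormedAddCommGroup E] [InnerProductSpace ℝ E]
  [NormedAddCommGroup F] [InnerProductSpace ℝ F]

/-- First-order condition for a local minimum of a separable quadratic function on a set. -/
theorem mem_regularNormalCone_of_isMin_quadratic {C : Set (WithLp 2 (E × F))}
    {z : WithLp 2 (E × F)} (hz : z ∈ C) (a : E) (b : F) {α β s : ℝ} (hα : 0 ≤ α) (hβ : 0 ≤ β)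
    (hs : 0 ≤ s)
    (hmin : ∀ᶠ y in 𝓝[C] z, α * ‖z.fst - a‖ ^ 2 + β * ‖z.snd - b‖ ^ 2 ≤
      α * ‖y.fst - a‖ ^ 2 + β * ‖y.snd - b‖ ^ 2) :
    WithLp.toLp 2 ((s * α) • (a - z.fst), (s * β) • (b - z.snd)) ∈ regularNormalCone C z := by
  refine mem_regularNormalCone_of_quadratic_bound hz (σ := s * (α + β) / 2) ?_
  filter_upwards [hmin] with y hy
  rw [inner_toLp_sub, real_inner_smul_left, real_inner_smul_left, WithLp.prod_norm_sq_eq_of_L2,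
    WithLp.sub_fst, WithLp.sub_snd]
  have e₁ : ‖y.fst - a‖ ^ 2 = ‖z.fst - a‖ ^ 2 - 2 * inner ℝ (a - z.fst) (y.fst - z.fst)
      + ‖y.fst - z.fst‖ ^ 2 := by
    rw [show y.fst - a = (y.fst - z.fst) - (a - z.fst) by abel, norm_sub_sq_real,
      real_inner_comm, norm_sub_rev z.fst a]
    ring
  have e₂ : ‖y.snd - b‖ ^ 2 = ‖z.snd - b‖ ^ 2 - 2 * inner ℝ (b - z.snd) (y.snd - z.snd)
      + ‖y.snd - z.snd‖ ^ 2 := by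
    rw [show y.snd - b = (y.snd - z.snd) - (b - z.snd) by abel, norm_sub_sq_real,
      real_inner_comm, norm_sub_rev z.snd b]
    ring
  rw [e₁, e₂] at hy
  -- After expansion about `z`, minimality bounds this linear part by half the weighted sum of
  -- squares; `α + β` dominates both weights.
  have h1 : α * inner ℝ (a - z.fst) (y.fst - z.fst) + β * inner ℝ (b - z.snd) (y.snd - z.snd) ≤
      (α + β) / 2 * (‖y.fst - z.fst‖ ^ 2 + ‖y.snd - z.snd‖ ^ 2) := by
    nlinarith [mul_nonneg hα (sq_nonneg ‖y.snd - z.snd‖), mul_nonneg hβ (sq_nonneg ‖y.fst - z.fst‖)]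
  nlinarith [mul_le_mul_of_nonneg_left h1 hs]

theorem isCompact_gph_inter_balls [FiniteDimensional ℝ E] [FiniteDimensional ℝ F]
    {S : E → Set F} (hS : IsClosed (gph S)) (a : E) (b : F) (r R : ℝ) :
    IsCompact (gph S ∩ {z | ‖z.fst - a‖ ≤ r ∧ ‖z.snd - b‖ ≤ R}) := by
  have : ProperSpace (WithLp 2 (E × F)) := FiniteDimensional.proper_real _
  refine Metric.isCompact_of_isClosed_isBounded (hS.inter ?_) ?_
  · have h₁ : Continuous fun z : WithLp 2 (E × F) => ‖z.fst - a‖ := by fun_prop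
    have h₂ : Continuous fun z : WithLp 2 (E × F) => ‖z.snd - b‖ := by fun_prop
    exact (isClosed_le h₁ continuous_const).inter (isClosed_le h₂ continuous_const)
  · refine (Metric.isBounded_closedBall (x := WithLp.toLp 2 (a, b)) (r := r + R)).subset ?_
    rintro z ⟨-, h₁, h₂⟩
    rw [mem_closedBall_iff_norm]
    exact (norm_le_norm_fst_add_norm_snd _).trans (add_le_add h₁ h₂)

end Penalty

section Inner

variable {G : Type*} [NormedAddCommGroup G] [InnerProductSpace ℝ G]

theorem norm_sub_add_smul_sq (p g e : G) (t : ℝ) : ‖p - (g + t • e)‖ ^ 2 =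
    ‖p - g‖ ^ 2 - 2 * t * inner ℝ e (p - g) + t ^ 2 * ‖e‖ ^ 2 := by
  rw [← sub_sub, norm_sub_sq_real, real_inner_smul_right, real_inner_comm, norm_smul, mul_pow,
    Real.norm_eq_abs, sq_abs]
  ring

theorem norm_inv_smul_sub_lt {g g₀ e : G} {t ε : ℝ} (ht : 0 < t) (h : ‖g - g₀‖ < t * ε) :
    ‖(t⁻¹ * 1) • (g₀ + t • e - g) - e‖ < ε := by
  have : (t⁻¹ * 1) • (g₀ + t • e - g) - e = t⁻¹ • (g₀ - g) := by
    rw [mul_one, add_sub_right_comm, smul_add, inv_smul_smul₀ ht.ne', add_sub_cancel_right]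
  rwa [this, norm_smul, norm_sub_rev, Real.norm_of_nonneg (inv_nonneg.2 ht.le),
    inv_mul_lt_iff₀ ht]

end Inner

/-! ### Approximate chain rule for regular normals by penalization. -/

section FuzzyChainRule

variable {E P F : Type*} [NormedAddCommGroup E] [InnerProductSpace ℝ E] [FiniteDimensional ℝ E]
  [NormedAddCommGroup P] [InnerProductSpace ℝ P] [FiniteDimensional ℝ P]
  [NormedAddCommGroup F] [InnerProductSpace ℝ F] [FiniteDimensional ℝ F]

/-- Approximate solutions of the coupling constraint `w₁ = w₂`: minimizers of the penalized
distance function approach a point of the graph of the composition. -/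
theorem exists_penalty_minimizers {T : E → Set P} {S : P → Set F} (hT : IsClosed (gph T))
    (hS : IsClosed (gph S)) {x₀ : E} {u₀ : F} {ρ R : ℝ} (hρ : 0 < ρ)
    (hR : ∀ x u w, ‖x - x₀‖ ≤ ρ → ‖u - u₀‖ ≤ ρ → w ∈ T x → u ∈ S w → ‖w‖ ≤ R)
    (h₀ : u₀ ∈ compMap S T x₀) (a : E) (b : F) :
    ∃ (k : ℕ → ℕ) (z₁ : ℕ → WithLp 2 (E × P)) (z₂ : ℕ → WithLp 2 (P × F)) (x : E) (w : P) (u : F),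
      (∀ j, z₁ j ∈ gph T) ∧ (∀ j, z₂ j ∈ gph S) ∧
      (∀ j, ∀ y₁ ∈ gph T, ∀ y₂ ∈ gph S, ‖y₁.fst - x₀‖ ≤ ρ → ‖y₁.snd‖ ≤ R + 1 →
        ‖y₂.snd - u₀‖ ≤ ρ → ‖y₂.fst‖ ≤ R + 1 →
        ‖(z₁ j).fst - a‖ ^ 2 + ‖(z₂ j).snd - b‖ ^ 2 + k j * ‖(z₁ j).snd - (z₂ j).fst‖ ^ 2 ≤
          ‖y₁.fst - a‖ ^ 2 + ‖y₂.snd - b‖ ^ 2 + k j * ‖y₁.snd - y₂.fst‖ ^ 2) ∧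
      Tendsto z₁ atTop (𝓝 (WithLp.toLp 2 (x, w))) ∧ Tendsto z₂ atTop (𝓝 (WithLp.toLp 2 (w, u))) ∧
      w ∈ T x ∧ u ∈ S w ∧ ‖x - x₀‖ ≤ ρ ∧ ‖u - u₀‖ ≤ ρ ∧
      ‖x - a‖ ^ 2 + ‖u - b‖ ^ 2 ≤ ‖x₀ - a‖ ^ 2 + ‖u₀ - b‖ ^ 2 := by
  obtain ⟨w₀, hw₀, hu₀⟩ : ∃ w₀, w₀ ∈ T x₀ ∧ u₀ ∈ S w₀ := by simpa [compMap] using h₀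
  have hw₀R : ‖w₀‖ ≤ R := hR x₀ u₀ w₀ (by simpa using hρ.le) (by simpa using hρ.le) hw₀ hu₀
  -- The radius `R + 1` leaves slack: feasible intermediate points have norm at most `R`, so the
  -- constraints on both copies are eventually inactive.
  set K : Set (WithLp 2 (E × P) × WithLp 2 (P × F)) :=
    (gph T ∩ {z | ‖z.fst - x₀‖ ≤ ρ ∧ ‖z.snd - 0‖ ≤ R + 1}) ×ˢ
      (gph S ∩ {z | ‖z.fst - 0‖ ≤ R + 1 ∧ ‖z.snd - u₀‖ ≤ ρ}) with hK
  have hKc : IsCompact K :=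
    (isCompact_gph_inter_balls hT _ _ _ _).prod (isCompact_gph_inter_balls hS _ _ _ _)
  have hp₀ : (WithLp.toLp 2 (x₀, w₀), WithLp.toLp 2 (w₀, u₀)) ∈ K := by
    refine ⟨⟨hw₀, ?_⟩, ⟨hu₀, ?_⟩⟩ <;> simp only [mem_ofPred_eq, WithLp.toLp_fst,
      WithLp.toLp_snd, sub_self, sub_zero, norm_zero] <;> constructor <;> linarith
  have hmin : ∀ k : ℕ, ∃ p ∈ K, ∀ y ∈ K,
      ‖p.1.fst - a‖ ^ 2 + ‖p.2.snd - b‖ ^ 2 + k * ‖p.1.snd - p.2.fst‖ ^ 2 ≤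
        ‖y.1.fst - a‖ ^ 2 + ‖y.2.snd - b‖ ^ 2 + k * ‖y.1.snd - y.2.fst‖ ^ 2 := by
    intro k
    exact hKc.exists_isMinOn ⟨_, hp₀⟩ (f := fun y : WithLp 2 (E × P) × WithLp 2 (P × F) =>
      ‖y.1.fst - a‖ ^ 2 + ‖y.2.snd - b‖ ^ 2 + k * ‖y.1.snd - y.2.fst‖ ^ 2) (by fun_prop)
  choose p hpK hpmin using hmin
  obtain ⟨⟨z₁, z₂⟩, hzK, φ, hφ, hlim⟩ := hKc.tendsto_subseq hpK
  have hlim₁ : Tendsto (fun j => (p (φ j)).1) atTop (𝓝 z₁) := (continuous_fst.tendsto _).comp hlim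
  have hlim₂ : Tendsto (fun j => (p (φ j)).2) atTop (𝓝 z₂) := (continuous_snd.tendsto _).comp hlim
  set c := ‖x₀ - a‖ ^ 2 + ‖u₀ - b‖ ^ 2 with hc
  have hval : ∀ k, ‖(p k).1.fst - a‖ ^ 2 + ‖(p k).2.snd - b‖ ^ 2 +
      k * ‖(p k).1.snd - (p k).2.fst‖ ^ 2 ≤ c := by
    -- The reference point is a competitor with zero penalty.
    intro k
    simpa [hc] using hpmin k _ hp₀
  have hwlim : Tendsto (fun j => ‖(p (φ j)).1.snd - (p (φ j)).2.fst‖ ^ 2) atTop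
      (𝓝 (‖z₁.snd - z₂.fst‖ ^ 2)) := by
    have : Continuous fun y : WithLp 2 (E × P) × WithLp 2 (P × F) => ‖y.1.snd - y.2.fst‖ ^ 2 := by
      fun_prop
    exact (this.tendsto _).comp hlim
  -- The penalty term is at most `c`, so the squared gap is at most `c / φ j`.
  have hw0 : Tendsto (fun j => ‖(p (φ j)).1.snd - (p (φ j)).2.fst‖ ^ 2) atTop (𝓝 0) := by
    have h0 : Tendsto (fun j => c / (φ j : ℝ)) atTop (𝓝 0) :=
      (tendsto_const_div_atTop_nhds_zero_nat c).comp hφ.tendsto_atTop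
    refine squeeze_zero' (.of_forall fun _ => sq_nonneg _) ?_ h0
    filter_upwards [eventually_gt_atTop 0] with j hj
    have hφj : (0 : ℝ) < φ j := by exact_mod_cast hj.trans_le (hφ.id_le j)
    rw [le_div_iff₀ hφj]
    nlinarith [hval (φ j), sq_nonneg ‖(p (φ j)).1.fst - a‖, sq_nonneg ‖(p (φ j)).2.snd - b‖]
  have hw : z₁.snd = z₂.fst := by
    have := tendsto_nhds_unique hwlim hw0
    exact sub_eq_zero.1 (norm_eq_zero.1 (pow_eq_zero_iff two_ne_zero |>.1 this))
  have hle : ‖z₁.fst - a‖ ^ 2 + ‖z₂.snd - b‖ ^ 2 ≤ c := by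
    have hcont : Continuous fun y : WithLp 2 (E × P) × WithLp 2 (P × F) =>
      ‖y.1.fst - a‖ ^ 2 + ‖y.2.snd - b‖ ^ 2 := by fun_prop
    refine le_of_tendsto ((hcont.tendsto _).comp hlim) (.of_forall fun j => ?_)
    have := hval (φ j)
    have h0 : 0 ≤ (φ j : ℝ) * ‖(p (φ j)).1.snd - (p (φ j)).2.fst‖ ^ 2 := by positivity
    simp only [Function.comp_apply]
    linarith
  obtain ⟨⟨hz₁, hz₁b⟩, ⟨hz₂, hz₂b⟩⟩ := hzK
  refine ⟨φ, fun j => (p (φ j)).1, fun j => (p (φ j)).2, z₁.fst, z₁.snd, z₂.snd,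
    fun j => (hpK _).1.1, fun j => (hpK _).2.1, ?_, hlim₁, ?_, hz₁, ?_, hz₁b.1, hz₂b.2, hle⟩
  · intro j y₁ h₁ y₂ h₂ hb₁ hb₂ hb₃ hb₄
    exact hpmin (φ j) (y₁, y₂) ⟨⟨h₁, hb₁, by simpa using hb₂⟩, ⟨h₂, by simpa using hb₄, hb₃⟩⟩
  · rw [hw]
    exact hlim₂
  · rw [hw]
    exact hz₂

/-- Fuzzy chain rule for regular normals to the graph of a composition. -/
theorem fuzzy_chain_rule_regular {T : E → Set P} {S : P → Set F} (hT : IsClosed (gph T))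
    (hS : IsClosed (gph S)) {x₀ : E} {u₀ : F} {r R : ℝ} (hr : 0 < r)
    (hR : ∀ x u w, ‖x - x₀‖ ≤ r → ‖u - u₀‖ ≤ r → w ∈ T x → u ∈ S w → ‖w‖ ≤ R)
    {v : E} {y : F}
    (hN : WithLp.toLp 2 (v, y) ∈ regularNormalCone (gph (compMap S T)) (WithLp.toLp 2 (x₀, u₀)))
    {ε : ℝ} (hε : 0 < ε) :
    ∃ (z₁ : WithLp 2 (E × P)) (z₂ : WithLp 2 (P × F)) (v' : E) (y' : F) (q : P),
      ‖z₁.fst - x₀‖ < ε ∧ ‖z₂.snd - u₀‖ < ε ∧ ‖z₁.snd - z₂.fst‖ < ε ∧ ‖z₁.snd‖ ≤ R + 1 ∧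
      ‖v' - v‖ < ε ∧ ‖y' - y‖ < ε ∧
      WithLp.toLp 2 (v', q) ∈ regularNormalCone (gph T) z₁ ∧
      WithLp.toLp 2 (-q, y') ∈ regularNormalCone (gph S) z₂ := by
  -- The factor `2 t` from expanding the shifted squares turns `ε / 4` into `t * ε / 2`, strictly
  -- below the tolerance `t * ε`.
  obtain ⟨δ, hδ, hN'⟩ := Metric.eventually_nhds_iff.1
    (eventually_nhdsWithin_iff.1 (hN.2 (ε / 4) (by positivity)))
  -- With `δ / 3` in each component, the product norm stays below `δ`.
  set ρ := min r (δ / 3) with hρdef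
  have hρ : 0 < ρ := lt_min hr (by positivity)
  set t := min (1 : ℝ) (ρ / ε) with htdef
  have ht : 0 < t := lt_min one_pos (by positivity)
  have htε : t * ε ≤ ε := mul_le_of_le_one_left hε.le (min_le_left _ _)
  have htρ : t * ε ≤ ρ := (le_div_iff₀ hε).1 (min_le_right _ _)
  obtain ⟨k, z₁, z₂, x, w, u, hz₁, hz₂, hmin, hlim₁, hlim₂, hw, hu, hx, hu', hle⟩ :=
    exists_penalty_minimizers hT hS hρ
      (fun x u w hx hu => hR x u w (hx.trans (min_le_left _ _)) (hu.trans (min_le_left _ _)))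
      hN.1 (x₀ + t • v) (u₀ + t • y)
  -- the limit point is close to the reference point
  have hclose : ‖WithLp.toLp 2 (x, u) - WithLp.toLp 2 (x₀, u₀)‖ ≤ t * ε / 2 := by
    set d := WithLp.toLp 2 (x, u) - WithLp.toLp 2 (x₀, u₀) with hd
    have hdδ : ‖d‖ < δ := by
      have h1 := norm_le_norm_fst_add_norm_snd d
      have h2 : ‖d.fst‖ ≤ δ / 3 := hx.trans (min_le_right _ _)
      have h3 : ‖d.snd‖ ≤ δ / 3 := hu'.trans (min_le_right _ _)
      linarith
    have hin : inner ℝ (WithLp.toLp 2 (v, y)) d ≤ ε / 4 * ‖d‖ := by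
      refine hN' (by rwa [dist_eq_norm]) ?_
      exact mem_biUnion hw hu
    simp only [norm_sub_add_smul_sq] at hle
    have hin' : inner ℝ v (x - x₀) + inner ℝ y (u - u₀) ≤ ε / 4 * ‖d‖ := by
      rw [hd, inner_toLp_sub] at hin
      exact hin
    have hsq : ‖d‖ ^ 2 = ‖x - x₀‖ ^ 2 + ‖u - u₀‖ ^ 2 := WithLp.prod_norm_sq_eq_of_L2 d
    simp only [sub_self, norm_zero, inner_zero_right] at hle
    have h2 : ‖d‖ ^ 2 ≤ t * ε / 2 * ‖d‖ := by nlinarith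
    by_contra! hcon
    have hpos : 0 < t * ε / 2 := by positivity
    nlinarith
  have hx2 : ‖x - x₀‖ ≤ t * ε / 2 :=
    (WithLp.norm_fst_le _ (WithLp.toLp 2 (x, u) - WithLp.toLp 2 (x₀, u₀))).trans hclose
  have hu2 : ‖u - u₀‖ ≤ t * ε / 2 :=
    (WithLp.norm_snd_le _ (WithLp.toLp 2 (x, u) - WithLp.toLp 2 (x₀, u₀))).trans hclose
  have hwR : ‖w‖ ≤ R := hR x u w (hx.trans (min_le_left _ _)) (hu'.trans (min_le_left _ _)) hw hu
  have htε0 : 0 < t * ε := by positivity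
  have hlimx : Tendsto (fun j => ‖(z₁ j).fst - x₀‖) atTop (𝓝 ‖x - x₀‖) := by
    have : Continuous fun z : WithLp 2 (E × P) => ‖z.fst - x₀‖ := by fun_prop
    exact (this.tendsto _).comp hlim₁
  have hlimw₁ : Tendsto (fun j => (z₁ j).snd) atTop (𝓝 w) := by
    have : Continuous fun z : WithLp 2 (E × P) => z.snd := by fun_prop
    exact (this.tendsto _).comp hlim₁
  have hlimw₂ : Tendsto (fun j => (z₂ j).fst) atTop (𝓝 w) := by
    have : Continuous fun z : WithLp 2 (P × F) => z.fst := by fun_prop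
    exact (this.tendsto _).comp hlim₂
  have hlimu : Tendsto (fun j => ‖(z₂ j).snd - u₀‖) atTop (𝓝 ‖u - u₀‖) := by
    have : Continuous fun z : WithLp 2 (P × F) => ‖z.snd - u₀‖ := by fun_prop
    exact (this.tendsto _).comp hlim₂
  have hlimw : Tendsto (fun j => ‖(z₁ j).snd - (z₂ j).fst‖) atTop (𝓝 0) := by
    simpa using (hlimw₁.sub hlimw₂).norm
  obtain ⟨j, hjx, hju, hjw, hjw₁, hjw₂⟩ := ((hlimx.eventually (gt_mem_nhds
    (show ‖x - x₀‖ < t * ε by linarith))).and ((hlimu.eventually (gt_mem_nhds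
    (show ‖u - u₀‖ < t * ε by linarith))).and ((hlimw.eventually (gt_mem_nhds hε)).and
    ((hlimw₁.norm.eventually (gt_mem_nhds (show ‖w‖ < R + 1 by linarith))).and
    (hlimw₂.norm.eventually (gt_mem_nhds (show ‖w‖ < R + 1 by linarith))))))).exists
  -- Strict inequalities make the box constraints inactive, so box minimizers are local minimizers
  -- on the graph.
  have hcont₁ : ∀ᶠ y₁ : WithLp 2 (E × P) in 𝓝 (z₁ j), ‖y₁.fst - x₀‖ < ρ ∧ ‖y₁.snd‖ < R + 1 := by
    have h₁ : Continuous fun z : WithLp 2 (E × P) => ‖z.fst - x₀‖ := by fun_prop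
    have h₂ : Continuous fun z : WithLp 2 (E × P) => ‖z.snd‖ := by fun_prop
    exact (h₁.continuousAt.eventually (gt_mem_nhds (hjx.trans_le htρ))).and
      (h₂.continuousAt.eventually (gt_mem_nhds hjw₁))
  have hcont₂ : ∀ᶠ y₂ : WithLp 2 (P × F) in 𝓝 (z₂ j), ‖y₂.snd - u₀‖ < ρ ∧ ‖y₂.fst‖ < R + 1 := by
    have h₁ : Continuous fun z : WithLp 2 (P × F) => ‖z.snd - u₀‖ := by fun_prop
    have h₂ : Continuous fun z : WithLp 2 (P × F) => ‖z.fst‖ := by fun_prop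
    exact (h₁.continuousAt.eventually (gt_mem_nhds (hju.trans_le htρ))).and
      (h₂.continuousAt.eventually (gt_mem_nhds hjw₂))
  -- With the other block frozen and the scale `t⁻¹`, the intermediate component is `(k / t)` times
  -- the gap; the other block yields its negative.
  have hN₁ := mem_regularNormalCone_of_isMin_quadratic (hz₁ j) (x₀ + t • v) (z₂ j).fst
    (zero_le_one' ℝ) (Nat.cast_nonneg (k j)) (inv_nonneg.2 ht.le) (by
      filter_upwards [nhdsWithin_le_nhds hcont₁, self_mem_nhdsWithin] with y₁ hy₁ hyT
      have := hmin j y₁ hyT (z₂ j) (hz₂ j) hy₁.1.le hy₁.2.le (hju.le.trans htρ) hjw₂.le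
      linarith)
  have hN₂ := mem_regularNormalCone_of_isMin_quadratic (hz₂ j) (z₁ j).snd (u₀ + t • y)
    (Nat.cast_nonneg (k j)) (zero_le_one' ℝ) (inv_nonneg.2 ht.le) (by
      filter_upwards [nhdsWithin_le_nhds hcont₂, self_mem_nhdsWithin] with y₂ hy₂ hyS
      have := hmin j (z₁ j) (hz₁ j) y₂ hyS (hjx.le.trans htρ) hjw₁.le hy₂.1.le hy₂.2.le
      rw [norm_sub_rev (z₂ j).fst, norm_sub_rev y₂.fst]
      linarith)
  refine ⟨z₁ j, z₂ j, _, _, _, hjx.trans_le htε, hju.trans_le htε, hjw, hjw₁.le,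
    norm_inv_smul_sub_lt ht hjx, norm_inv_smul_sub_lt ht hju, hN₁, ?_⟩
  rw [← smul_neg, neg_sub]
  exact hN₂

end FuzzyChainRule

/-! ### Limiting chain rule and the projectional inclusion. -/

section ChainRule

variable {E P F : Type*} [NormedAddCommGroup E] [InnerProductSpace ℝ E] [FiniteDimensional ℝ E]
  [NormedAddCommGroup P] [InnerProductSpace ℝ P] [FiniteDimensional ℝ P]
  [NormedAddCommGroup F] [InnerProductSpace ℝ F] [FiniteDimensional ℝ F]

theorem tendsto_of_norm_sub_lt_one_div {G : Type*} [SeminormedAddCommGroup G] {g : ℕ → G} {a : G}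
    (h : ∀ k : ℕ, ‖g k - a‖ < 1 / ((k : ℝ) + 1)) : Tendsto g atTop (𝓝 a) :=
  tendsto_iff_norm_sub_tendsto_zero.2 (squeeze_zero (fun _ => norm_nonneg _) (fun k => (h k).le)
    (tendsto_one_div_add_atTop_nhds_zero_nat (𝕜 := ℝ)))

theorem tendsto_toLp {ι E F : Type*} [SeminormedAddCommGroup E] [SeminormedAddCommGroup F]
    {l : Filter ι} {f : ι → E} {g : ι → F} {a : E} {b : F} (hf : Tendsto f l (𝓝 a))
    (hg : Tendsto g l (𝓝 b)) :
    Tendsto (fun i => WithLp.toLp 2 (f i, g i)) l (𝓝 (WithLp.toLp 2 (a, b))) :=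
  ((WithLp.prod_continuous_toLp 2 E F).tendsto _).comp (hf.prodMk_nhds hg)

/-- Fuzzy chain rule for limiting normals to the graph of a composition. -/
theorem fuzzy_chain_rule {T : E → Set P} {S : P → Set F} (hT : IsClosed (gph T))
    (hS : IsClosed (gph S)) {x₀ : E} {u₀ : F} {r R : ℝ} (hr : 0 < r)
    (hR : ∀ x u w, ‖x - x₀‖ ≤ r → ‖u - u₀‖ ≤ r → w ∈ T x → u ∈ S w → ‖w‖ ≤ R)
    {v : E} {y : F}
    (hN : WithLp.toLp 2 (v, y) ∈ normalCone (gph (compMap S T)) (WithLp.toLp 2 (x₀, u₀)))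
    {ε : ℝ} (hε : 0 < ε) :
    ∃ (z₁ : WithLp 2 (E × P)) (z₂ : WithLp 2 (P × F)) (v' : E) (y' : F) (q : P),
      ‖z₁.fst - x₀‖ < ε ∧ ‖z₂.snd - u₀‖ < ε ∧ ‖z₁.snd - z₂.fst‖ < ε ∧ ‖z₁.snd‖ ≤ R + 1 ∧
      ‖v' - v‖ < ε ∧ ‖y' - y‖ < ε ∧
      WithLp.toLp 2 (v', q) ∈ regularNormalCone (gph T) z₁ ∧
      WithLp.toLp 2 (-q, y') ∈ regularNormalCone (gph S) z₂ := by
  -- Within `r / 2` of the reference point, the boundedness hypothesis survives on balls of radius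
  -- `r / 2` about `z`.
  obtain ⟨z, -, ζ, hζ, hz, hζ'⟩ := mem_outerLimit_nhdsWithin.1 hN.2 (min (ε / 2) (r / 2))
    (by positivity)
  rw [dist_eq_norm] at hz hζ'
  have hz₁ := (WithLp.norm_fst_le _ _).trans_lt hz
  have hz₂ := (WithLp.norm_snd_le _ _).trans_lt hz
  have hζ₁ := (WithLp.norm_fst_le _ _).trans_lt hζ'
  have hζ₂ := (WithLp.norm_snd_le _ _).trans_lt hζ'
  simp only [WithLp.sub_fst, WithLp.sub_snd, WithLp.toLp_fst, WithLp.toLp_snd, lt_min_iff]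
    at hz₁ hz₂ hζ₁ hζ₂
  obtain ⟨z₁, z₂, v', y', q, h₁, h₂, h₃, h₄, h₅, h₆, h₇, h₈⟩ :=
    fuzzy_chain_rule_regular hT hS (half_pos hr) (x₀ := z.fst) (u₀ := z.snd) (R := R)
      (fun x u w hx hu => hR x u w
        (by linarith [norm_sub_le_norm_sub_add_norm_sub x z.fst x₀])
        (by linarith [norm_sub_le_norm_sub_add_norm_sub u z.snd u₀]))
      (v := ζ.fst) (y := ζ.snd) hζ (half_pos hε)
  refine ⟨z₁, z₂, v', y', q, ?_, ?_, by linarith, h₄, ?_, ?_, h₇, h₈⟩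
  · linarith [norm_sub_le_norm_sub_add_norm_sub z₁.fst z.fst x₀]
  · linarith [norm_sub_le_norm_sub_add_norm_sub z₂.snd z.snd u₀]
  · linarith [norm_sub_le_norm_sub_add_norm_sub v' ζ.fst v]
  · linarith [norm_sub_le_norm_sub_add_norm_sub y' ζ.snd y]

/-- The normalization passes to the limit, so the limiting multipliers cannot both vanish. -/
theorem exists_subseq_multipliers {w q : ℕ → P} {l : ℕ → ℝ} {R : ℝ} (hw : ∀ k, ‖w k‖ ≤ R)
    (hl : ∀ k, 0 ≤ l k) (hlq : ∀ k, l k + ‖q k‖ = 1) :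
    ∃ (φ : ℕ → ℕ) (w₀ q₀ : P) (l₀ : ℝ), StrictMono φ ∧ Tendsto (w ∘ φ) atTop (𝓝 w₀) ∧
      Tendsto (q ∘ φ) atTop (𝓝 q₀) ∧ Tendsto (l ∘ φ) atTop (𝓝 l₀) ∧ 0 ≤ l₀ ∧ l₀ + ‖q₀‖ = 1 := by
  have : ProperSpace P := FiniteDimensional.proper_real _
  have hK : IsCompact (Metric.closedBall (0 : P) R ×ˢ Metric.closedBall (0 : P) 1 ×ˢ Icc (0 : ℝ) 1) :=
    (isCompact_closedBall _ _).prod ((isCompact_closedBall _ _).prod isCompact_Icc)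
  obtain ⟨⟨w₀, q₀, l₀⟩, -, φ, hφ, hlim⟩ := hK.tendsto_subseq (x := fun k => (w k, q k, l k))
    (fun k => ⟨by simpa using hw k, by simpa using by linarith [hl k, hlq k],
      hl k, by linarith [norm_nonneg (q k), hlq k]⟩)
  have hwl : Tendsto (w ∘ φ) atTop (𝓝 w₀) := (continuous_fst.tendsto _).comp hlim
  have hql : Tendsto (q ∘ φ) atTop (𝓝 q₀) :=
    ((continuous_fst.comp continuous_snd).tendsto _).comp hlim
  have hll : Tendsto (l ∘ φ) atTop (𝓝 l₀) :=
    ((continuous_snd.comp continuous_snd).tendsto _).comp hlim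
  refine ⟨φ, w₀, q₀, l₀, hφ, hwl, hql, hll, ge_of_tendsto' hll fun k => hl _, ?_⟩
  refine tendsto_nhds_unique (hll.add hql.norm) ?_
  simp only [Function.comp_apply, hlq]
  exact tendsto_const_nhds

/-- Chain rule for limiting normals without a qualification condition, in Fritz John form. -/
theorem exists_multiplier_of_mem_normalCone_compMap {T : E → Set P} {S : P → Set F}
    (hT : IsClosed (gph T)) (hS : IsClosed (gph S)) {x₀ : E} {u₀ : F} {r R : ℝ} (hr : 0 < r)
    (hR : ∀ x u w, ‖x - x₀‖ ≤ r → ‖u - u₀‖ ≤ r → w ∈ T x → u ∈ S w → ‖w‖ ≤ R)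
    {v : E} {y : F}
    (hN : WithLp.toLp 2 (v, y) ∈ normalCone (gph (compMap S T)) (WithLp.toLp 2 (x₀, u₀))) :
    ∃ (w : P) (l : ℝ) (q : P), w ∈ T x₀ ∧ u₀ ∈ S w ∧ 0 ≤ l ∧ l + ‖q‖ = 1 ∧
      WithLp.toLp 2 (l • v, q) ∈ normalCone (gph T) (WithLp.toLp 2 (x₀, w)) ∧
      WithLp.toLp 2 (-q, l • y) ∈ normalCone (gph S) (WithLp.toLp 2 (w, u₀)) := by
  choose z₁ z₂ v' y' q hx hu hw hwR hv hy hN₁ hN₂ using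
    fun k : ℕ => fuzzy_chain_rule hT hS hr hR hN (Nat.one_div_pos_of_nat (α := ℝ) (n := k))
  -- This scale gives `l + ‖l • q‖ = 1`, even if `q` blows up; blow-up shows as `l → 0`.
  set l : ℕ → ℝ := fun k => (1 + ‖q k‖)⁻¹ with hl
  have hl0 : ∀ k, 0 ≤ l k := fun k => by positivity
  obtain ⟨φ, w₀, q₀, l₀, hφ, hw₀, hq₀, hll₀, hl₀, hlq⟩ :=
    exists_subseq_multipliers (w := fun k => (z₁ k).snd) (q := fun k => l k • q k) hwR hl0
      (fun k => by
        have : 0 < 1 + ‖q k‖ := by positivity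
        rw [norm_smul, Real.norm_of_nonneg (hl0 k), hl]
        field_simp)
  have hφ' := hφ.tendsto_atTop
  have hx' := (tendsto_of_norm_sub_lt_one_div hx).comp hφ'
  have hu' := (tendsto_of_norm_sub_lt_one_div hu).comp hφ'
  have hv' := (tendsto_of_norm_sub_lt_one_div hv).comp hφ'
  have hy' := (tendsto_of_norm_sub_lt_one_div hy).comp hφ'
  have hdiff : Tendsto (fun k => (z₁ k).snd - (z₂ k).fst) atTop (𝓝 0) :=
    tendsto_of_norm_sub_lt_one_div (by simpa using hw)
  have hw₂ : Tendsto (fun k => (z₂ (φ k)).fst) atTop (𝓝 w₀) := by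
    simpa using hw₀.sub (hdiff.comp hφ')
  have hz₁ : Tendsto (z₁ ∘ φ) atTop (𝓝 (WithLp.toLp 2 (x₀, w₀))) := tendsto_toLp hx' hw₀
  have hz₂ : Tendsto (z₂ ∘ φ) atTop (𝓝 (WithLp.toLp 2 (w₀, u₀))) := tendsto_toLp hw₂ hu'
  have hmem₁ : WithLp.toLp 2 (x₀, w₀) ∈ gph T :=
    hT.mem_of_tendsto hz₁ (.of_forall fun k => (hN₁ _).1)
  have hmem₂ : WithLp.toLp 2 (w₀, u₀) ∈ gph S :=
    hS.mem_of_tendsto hz₂ (.of_forall fun k => (hN₂ _).1)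
  refine ⟨w₀, l₀, q₀, hmem₁, hmem₂, hl₀, hlq, ?_, ?_⟩
  · refine mem_normalCone_of_tendsto hmem₁ hz₁ (tendsto_toLp (hll₀.smul hv') hq₀) fun k => ?_
    exact regularNormalCone_subset_normalCone _ _
      (smul_mem_regularNormalCone (hl0 (φ k)) (hN₁ (φ k)))
  · refine mem_normalCone_of_tendsto hmem₂ hz₂ (tendsto_toLp hq₀.neg (hll₀.smul hy')) fun k => ?_
    have := regularNormalCone_subset_normalCone _ _
      (smul_mem_regularNormalCone (hl0 (φ k)) (hN₂ (φ k)))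
    rwa [← WithLp.toLp_smul, Prod.smul_mk, smul_neg] at this

theorem restrictMap_compMap {α β γ : Type*} (S₂ : β → Set γ) (S₁ : α → Set β) (X : Set α) :
    restrictMap (compMap S₂ S₁) X = compMap S₂ (restrictMap S₁ X) := by
  ext x u
  simp only [restrictMap, compMap, mem_ofPred_eq, mem_iUnion, exists_prop]
  tauto

/-- The inclusion part of the projectional coderivative chain rule. -/
theorem projCoderivative_compMap_subset {X : Set E} {S₁ : E → Set P} {S₂ : P → Set F}
    (hT : IsClosed (gph (restrictMap S₁ X))) (hS : IsClosed (gph S₂)) {x₀ : E} {u₀ : F} {r R : ℝ}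
    (hr : 0 < r) (hR : ∀ x u w, ‖x - x₀‖ ≤ r → ‖u - u₀‖ ≤ r → w ∈ restrictMap S₁ X x → u ∈ S₂ w →
      ‖w‖ ≤ R)
    (hCQ : ∀ w₀ ∈ restrictMap S₁ X x₀ ∩ invMap S₂ u₀,
      coderivative S₂ w₀ u₀ 0 ∩ invMap (projCoderivative X S₁ x₀ w₀) 0 = {0}) (u' : F) :
    projCoderivative X (compMap S₂ S₁) x₀ u₀ u' ⊆
      ⋃ w₀ ∈ restrictMap S₁ X x₀ ∩ invMap S₂ u₀,
        compMap (projCoderivative X S₁ x₀ w₀) (coderivative S₂ w₀ u₀) u' := by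
  intro t ht
  rw [projCoderivative, mem_ofPred_eq, restrictMap_compMap] at ht
  have happrox : ∀ ε : ℝ, 0 < ε → ∃ (x : E) (w : P) (u : F) (t' : E) (y : F) (l : ℝ) (q : P),
      ‖x - x₀‖ < ε ∧ ‖u - u₀‖ < ε ∧ ‖t' - t‖ < ε ∧ ‖y - -u'‖ < ε ∧ w ∈ restrictMap S₁ X x ∧
      ‖w‖ ≤ R ∧ 0 ≤ l ∧ l + ‖q‖ = 1 ∧
      WithLp.toLp 2 (l • t', q) ∈ projSet {y : WithLp 2 (E × P) | y.fst ∈ tangentCone X x}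
        (normalCone (gph (restrictMap S₁ X)) (WithLp.toLp 2 (x, w))) ∧
      WithLp.toLp 2 (-q, l • y) ∈ normalCone (gph S₂) (WithLp.toLp 2 (w, u)) := by
    intro ε hε
    obtain ⟨z, hzG, ζ, hζ, hz, hζ'⟩ := mem_outerLimit_nhdsWithin.1 ht (min ε (r / 2))
      (by positivity)
    rw [dist_eq_norm] at hz hζ'
    have hz₁ := (WithLp.norm_fst_le _ _).trans_lt hz
    have hz₂ := (WithLp.norm_snd_le _ _).trans_lt hz
    have hζ₁ := (WithLp.norm_fst_le _ _).trans_lt hζ'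
    have hζ₂ := (WithLp.norm_snd_le _ _).trans_lt hζ'
    simp only [WithLp.sub_fst, WithLp.sub_snd, WithLp.toLp_fst, WithLp.toLp_snd, lt_min_iff]
      at hz₁ hz₂ hζ₁ hζ₂
    obtain ⟨v, hv, htan, hmin⟩ :=
      mem_projSet_fst_iff.1 (show WithLp.toLp 2 (ζ.fst, ζ.snd) ∈ _ from hζ)
    -- The exact rule keeps the base point `z.fst`, so the tangent cone in the projection does not
    -- change.
    obtain ⟨w, l, q, hw, hu, hl, hlq, hN₁, hN₂⟩ :=
      exists_multiplier_of_mem_normalCone_compMap hT hS (half_pos hr) (x₀ := z.fst) (u₀ := z.snd)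
        (R := R) (fun x u w hx hu => hR x u w
          (by linarith [norm_sub_le_norm_sub_add_norm_sub x z.fst x₀])
          (by linarith [norm_sub_le_norm_sub_add_norm_sub u z.snd u₀])) hv
    exact ⟨z.fst, w, z.snd, ζ.fst, ζ.snd, l, q, hz₁.1, hz₂.1, hζ₁.1, hζ₂.1, hw,
      hR _ _ _ (by linarith) (by linarith) hw hu, hl, hlq,
      mem_projSet_fst_iff.2 ⟨l • v, hN₁, smul_mem_tangentCone hl htan,
        nearest_smul_tangentCone hl hmin⟩, hN₂⟩
  choose x w u t' y l q hx hu ht' hy hw hwR hl hlq hN₁ hN₂ using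
    fun k : ℕ => happrox _ (Nat.one_div_pos_of_nat (α := ℝ) (n := k))
  obtain ⟨φ, w₀, q₀, l₀, hφ, hw₀, hq₀, hll₀, hl₀, hlq₀⟩ := exists_subseq_multipliers hwR hl hlq
  have hφ' := hφ.tendsto_atTop
  have hx' := (tendsto_of_norm_sub_lt_one_div hx).comp hφ'
  have hu' := (tendsto_of_norm_sub_lt_one_div hu).comp hφ'
  have ht'' := (tendsto_of_norm_sub_lt_one_div ht').comp hφ'
  have hy' := (tendsto_of_norm_sub_lt_one_div hy).comp hφ'
  have hz₁ : Tendsto (fun k => WithLp.toLp 2 (x (φ k), w (φ k))) atTop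
    (𝓝 (WithLp.toLp 2 (x₀, w₀))) := tendsto_toLp hx' hw₀
  have hz₂ : Tendsto (fun k => WithLp.toLp 2 (w (φ k), u (φ k))) atTop
    (𝓝 (WithLp.toLp 2 (w₀, u₀))) := tendsto_toLp hw₀ hu'
  have hmem₁ : WithLp.toLp 2 (x₀, w₀) ∈ gph (restrictMap S₁ X) :=
    hT.mem_of_tendsto hz₁ (.of_forall fun k => hw _)
  have hmem₂ : WithLp.toLp 2 (w₀, u₀) ∈ gph S₂ :=
    hS.mem_of_tendsto hz₂ (.of_forall fun k => (hN₂ _).1)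
  have hcod : -q₀ ∈ coderivative S₂ w₀ u₀ (l₀ • u') := by
    rw [coderivative, mem_ofPred_eq, ← smul_neg]
    exact mem_normalCone_of_tendsto hmem₂ hz₂ (tendsto_toLp hq₀.neg (hll₀.smul hy'))
      fun k => hN₂ _
  have hproj : l₀ • t ∈ projCoderivative X S₁ x₀ w₀ (-q₀) := by
    rw [projCoderivative, mem_ofPred_eq, neg_neg]
    exact ⟨_, _, tendsto_nhdsWithin_iff.2 ⟨hz₁, .of_forall fun k => hw _⟩, fun k => hN₁ _,
      tendsto_toLp (hll₀.smul ht'') hq₀⟩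
  refine mem_biUnion (x := w₀) ⟨hmem₁, hmem₂⟩ ?_
  -- The qualification condition excludes `l₀ = 0`: it would force `q₀ = 0`, against the
  -- normalization.
  rcases hl₀.eq_or_lt with rfl | hpos
  · rw [zero_smul] at hcod hproj
    have h0 : -q₀ ∈ ({0} : Set P) := hCQ w₀ ⟨hmem₁, hmem₂⟩ ▸ ⟨hcod, hproj⟩
    rw [mem_singleton_iff, neg_eq_zero] at h0
    simp [h0] at hlq₀
  · have h₁ := smul_mem_coderivative (inv_nonneg.2 hpos.le) hcod
    have h₂ := smul_mem_projCoderivative (inv_nonneg.2 hpos.le) hproj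
    rw [inv_smul_smul₀ hpos.ne'] at h₁ h₂
    exact mem_biUnion h₁ h₂

end ChainRule

/-! ### Closed graphs and local boundedness. -/

section Semicontinuity

variable {E F : Type*} [NormedAddCommGroup E]
  [NormedAddCommGroup F]

theorem OuterSemicontinuousRel.mem_of_tendsto {S : E → Set F} {X : Set E}
    (hS : OuterSemicontinuousRel S X) {z : ℕ → E} {v : ℕ → F} {x : E} {u : F} (hx : x ∈ X)
    (hzX : ∀ k, z k ∈ X) (hz : Tendsto z atTop (𝓝 x)) (hv : ∀ k, v k ∈ S (z k))
    (hvu : Tendsto v atTop (𝓝 u)) : u ∈ S x :=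
  (hS x hx).2 ▸ ⟨z, v, tendsto_nhdsWithin_iff.2 ⟨hz, .of_forall hzX⟩, hv, hvu⟩

/-- Closedness of `X` puts the limit base point in `X`, where semicontinuity relative to `X`
applies. -/
theorem isClosed_gph_restrictMap {S : E → Set F} {X : Set E} (hX : IsClosed X)
    (hS : OuterSemicontinuousRel S X) : IsClosed (gph (restrictMap S X)) := by
  refine IsSeqClosed.isClosed fun z z₀ hz hlim => ?_
  have h₁ : Tendsto (fun k => (z k).fst) atTop (𝓝 z₀.fst) :=
    ((WithLp.continuous_fst 2 E F).tendsto _).comp hlim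
  have h₂ : Tendsto (fun k => (z k).snd) atTop (𝓝 z₀.snd) :=
    ((WithLp.continuous_snd 2 E F).tendsto _).comp hlim
  have hX₀ : z₀.fst ∈ X := hX.mem_of_tendsto h₁ (.of_forall fun k => (hz k).1)
  exact ⟨hX₀, hS.mem_of_tendsto hX₀ (fun k => (hz k).1) h₁ (fun k => (hz k).2) h₂⟩

theorem isClosed_gph {S : E → Set F} (hS : OuterSemicontinuousRel S univ) : IsClosed (gph S) := by
  have : restrictMap S univ = S := by
    ext x u
    simp [restrictMap]
  rw [← this]
  exact isClosed_gph_restrictMap isClosed_univ hS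

variable {P : Type*} [NormedAddCommGroup P]

theorem locallyBoundedRel_restrict_iff {S₁ : E → Set P} {S₂ : P → Set F} {X : Set E} {z₀ : E × F} :
    LocallyBoundedRel (fun z : E × F => restrictMap S₁ X z.1 ∩ invMap S₂ z.2) univ z₀ ↔
      LocallyBoundedRel (fun z : E × F => S₁ z.1 ∩ invMap S₂ z.2) (X ×ˢ univ) z₀ := by
  refine exists_congr fun V => and_congr_right fun _ => iff_of_eq (congrArg _ ?_)
  ext w
  simp only [restrictMap, mem_iUnion, mem_inter_iff, mem_ofPred_eq, mem_prod, mem_univ, exists_prop,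
    and_true]
  tauto

theorem locallyBoundedRel_of_left {S₁ : E → Set P} {S₂ : P → Set F} {X : Set E} {x₀ : E} {u₀ : F}
    (h : LocallyBoundedRel S₁ X x₀) :
    LocallyBoundedRel (fun z : E × F => restrictMap S₁ X z.1 ∩ invMap S₂ z.2) univ (x₀, u₀) := by
  obtain ⟨V, hV, hb⟩ := h
  refine ⟨V ×ˢ univ, prod_mem_nhds hV univ_mem, hb.subset ?_⟩
  refine iUnion₂_subset fun z hz w hw => ?_
  exact mem_biUnion (x := z.1) ⟨hz.1.1, hw.1.1⟩ hw.1.2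

theorem locallyBoundedRel_of_right {S₁ : E → Set P} {S₂ : P → Set F} {X : Set E} {x₀ : E} {u₀ : F}
    (h : LocallyBoundedRel (invMap S₂) univ u₀) :
    LocallyBoundedRel (fun z : E × F => restrictMap S₁ X z.1 ∩ invMap S₂ z.2) univ (x₀, u₀) := by
  obtain ⟨V, hV, hb⟩ := h
  refine ⟨univ ×ˢ V, prod_mem_nhds univ_mem hV, hb.subset ?_⟩
  refine iUnion₂_subset fun z hz w hw => ?_
  exact mem_biUnion (x := z.2) ⟨hz.1.2, mem_univ _⟩ hw.2

theorem LocallyBoundedRel.exists_bound {T : E → Set P} {S : P → Set F} {x₀ : E} {u₀ : F}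
    (h : LocallyBoundedRel (fun z : E × F => T z.1 ∩ invMap S z.2) univ (x₀, u₀)) :
    ∃ r R : ℝ, 0 < r ∧
      ∀ x u w, ‖x - x₀‖ ≤ r → ‖u - u₀‖ ≤ r → w ∈ T x → u ∈ S w → ‖w‖ ≤ R := by
  obtain ⟨V, hV, hb⟩ := h
  obtain ⟨r, hr, hrV⟩ := Metric.nhds_basis_closedBall.mem_iff.1 hV
  obtain ⟨R, hR⟩ := hb.exists_norm_le
  refine ⟨r, R, hr, fun x u w hx hu hw hwu => hR w ?_⟩
  refine mem_biUnion (x := (x, u)) ⟨hrV ?_, mem_univ _⟩ ⟨hw, hwu⟩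
  -- The plain product carries the sup norm, so its balls are products of balls.
  rw [mem_closedBall_iff_norm]
  exact max_le hx hu

end Semicontinuity

/-! ### Closedness of compositions. -/

section Composition

variable {E P F : Type*} [NormedAddCommGroup E]
  [NormedAddCommGroup P] [NormedSpace ℝ P] [FiniteDimensional ℝ P]
  [NormedAddCommGroup F]

/-- Under uniform boundedness of the intermediate points, limits of points of the graph of a
composition stay in the graph. -/
theorem mem_compMap_of_tendsto {T : E → Set P} {S : P → Set F} (hT : IsClosed (gph T))
    (hS : IsClosed (gph S)) {x₀ : E} {u₀ : F} {r R : ℝ}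
    (hR : ∀ x u w, ‖x - x₀‖ ≤ r → ‖u - u₀‖ ≤ r → w ∈ T x → u ∈ S w → ‖w‖ ≤ R)
    {x : ℕ → E} {u : ℕ → F} {x₁ : E} {u₁ : F} (hx : Tendsto x atTop (𝓝 x₁))
    (hu : Tendsto u atTop (𝓝 u₁)) (hxr : ∀ᶠ k in atTop, ‖x k - x₀‖ ≤ r)
    (hur : ∀ᶠ k in atTop, ‖u k - u₀‖ ≤ r) (hmem : ∀ k, u k ∈ compMap S T (x k)) :
    u₁ ∈ compMap S T x₁ := by
  have : ProperSpace P := FiniteDimensional.proper_real _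
  have hex : ∀ k, ∃ w, w ∈ T (x k) ∧ u k ∈ S w := fun k => by simpa [compMap] using hmem k
  choose w hw hwu using hex
  -- The intermediate points are eventually bounded, so a subsequence converges; closedness of both
  -- graphs then applies to its limit.
  obtain ⟨w₁, -, φ, hφ, hlim⟩ := (isCompact_closedBall (0 : P) R).tendsto_subseq'
    (x := w) (by
      refine Eventually.frequently ?_
      filter_upwards [hxr, hur] with k h₁ h₂
      simpa using hR _ _ _ h₁ h₂ (hw k) (hwu k))
  have hφ' := hφ.tendsto_atTop
  refine mem_biUnion (x := w₁) ?_ ?_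
  · exact hT.mem_of_tendsto (tendsto_toLp (hx.comp hφ') hlim) (.of_forall fun k => hw _)
  · exact hS.mem_of_tendsto (tendsto_toLp hlim (hu.comp hφ')) (.of_forall fun k => hwu _)

theorem locallyClosedAt_gph_compMap {T : E → Set P} {S : P → Set F} (hT : IsClosed (gph T))
    (hS : IsClosed (gph S)) {x₀ : E} {u₀ : F} {r R : ℝ} (hr : 0 < r)
    (hR : ∀ x u w, ‖x - x₀‖ ≤ r → ‖u - u₀‖ ≤ r → w ∈ T x → u ∈ S w → ‖w‖ ≤ R) :
    LocallyClosedAt (gph (compMap S T)) (WithLp.toLp 2 (x₀, u₀)) := by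
  refine ⟨Metric.closedBall _ r, Metric.closedBall_mem_nhds _ hr, Metric.isClosed_closedBall,
    IsSeqClosed.isClosed fun z z₀ hz hlim => ⟨?_, ?_⟩⟩
  · refine mem_compMap_of_tendsto hT hS hR
      (((WithLp.continuous_fst 2 E F).tendsto _).comp hlim)
      (((WithLp.continuous_snd 2 E F).tendsto _).comp hlim) (.of_forall fun k => ?_)
      (.of_forall fun k => ?_) fun k => (hz k).1
    · exact (WithLp.norm_fst_le _ _).trans (mem_closedBall_iff_norm.1 (hz k).2)
    · exact (WithLp.norm_snd_le _ _).trans (mem_closedBall_iff_norm.1 (hz k).2)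
  · exact Metric.isClosed_closedBall.mem_of_tendsto hlim (.of_forall fun k => (hz k).2)

/-- The limit value is arbitrary, so boundedness is required at every `u`. -/
theorem outerSemicontinuousAtRel_compMap {T : E → Set P} {S : P → Set F} (hT : IsClosed (gph T))
    (hS : IsClosed (gph S)) {x₀ : E}
    (h : ∀ u, LocallyBoundedRel (fun z : E × F => T z.1 ∩ invMap S z.2) univ (x₀, u)) :
    OuterSemicontinuousAtRel (compMap S T) univ x₀ := by
  refine ⟨mem_univ _, Subset.antisymm ?_ (subset_outerLimit_nhdsWithin _ (mem_univ _))⟩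
  rintro u₀ ⟨x, u, hx, hmem, hu⟩
  obtain ⟨r, R, hr, hR⟩ := (h u₀).exists_bound
  have hx := (tendsto_nhdsWithin_iff.1 hx).1
  refine mem_compMap_of_tendsto hT hS hR hx hu ?_ ?_ hmem
  · filter_upwards [hx.eventually (Metric.closedBall_mem_nhds _ hr)] with k hk
    exact mem_closedBall_iff_norm.1 hk
  · filter_upwards [hu.eventually (Metric.closedBall_mem_nhds _ hr)] with k hk
    exact mem_closedBall_iff_norm.1 hk

end Composition

/-! ### The Lipschitz-like criterion. -/

section Lipschitz

variable {E F : Type*} [NormedAddCommGroup E] [InnerProductSpace ℝ E]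
  [NormedAddCommGroup F] [InnerProductSpace ℝ F]

/-- Regular normals near a point where the mapping is Lipschitz-like satisfy the norm bound of the
Lipschitz modulus. -/
theorem norm_fst_le_of_mem_regularNormalCone {S : E → Set F} {V : Set E} {W : Set F} {κ : ℝ}
    (hκ : 0 ≤ κ)
    (hLip : ∀ y ∈ V, ∀ y' ∈ V, ∀ v' ∈ S y' ∩ W, ∃ v ∈ S y, ‖v' - v‖ ≤ κ * ‖y' - y‖)
    {z : WithLp 2 (E × F)} (hV : V ∈ 𝓝 z.fst) (hW : z.snd ∈ W) {ζ : WithLp 2 (E × F)}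
    (hζ : ζ ∈ regularNormalCone (gph S) z) : ‖ζ.fst‖ ≤ κ * ‖ζ.snd‖ := by
  rcases eq_or_ne ζ.fst 0 with h0 | h0
  · rw [h0, norm_zero]
    positivity
  have hpos : 0 < ‖ζ.fst‖ := norm_pos_iff.2 h0
  refine le_of_forall_pos_le_add fun ε hε => ?_
  obtain ⟨δ, hδ, hN⟩ := Metric.eventually_nhds_iff.1
    (eventually_nhdsWithin_iff.1 (hζ.2 (ε / (1 + κ)) (by positivity)))
  -- Move the base point along `ζ.fst`. The Lipschitz property supplies a graph point above it at
  -- distance at most `(1 + κ) * s * ‖ζ.fst‖`, whence the tolerance `ε / (1 + κ)`.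
  have hcurve : Tendsto (fun s : ℝ => z.fst + s • ζ.fst) (𝓝[>] 0) (𝓝 z.fst) := by
    have : Continuous fun s : ℝ => z.fst + s • ζ.fst := by fun_prop
    simpa using (this.tendsto 0).mono_left nhdsWithin_le_nhds
  have hsmall : Tendsto (fun s : ℝ => (1 + κ) * (s * ‖ζ.fst‖)) (𝓝[>] 0) (𝓝 0) := by
    have : Continuous fun s : ℝ => (1 + κ) * (s * ‖ζ.fst‖) := by fun_prop
    simpa using (this.tendsto 0).mono_left nhdsWithin_le_nhds
  obtain ⟨s, ⟨hsV, hsδ⟩, hs0⟩ := ((hcurve.eventually hV).and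
    (hsmall.eventually (gt_mem_nhds hδ)) |>.and self_mem_nhdsWithin).exists
  have hs : 0 < s := hs0
  obtain ⟨u, hu, hle⟩ := hLip _ hsV _ (mem_of_mem_nhds hV) z.snd ⟨hζ.1, hW⟩
  rw [sub_add_cancel_left, norm_neg, norm_smul, Real.norm_of_nonneg hs.le, norm_sub_rev] at hle
  have hdist : ‖WithLp.toLp 2 (z.fst + s • ζ.fst, u) - z‖ ≤ (1 + κ) * (s * ‖ζ.fst‖) := by
    refine (norm_le_norm_fst_add_norm_snd _).trans ?_
    rw [WithLp.sub_fst, WithLp.sub_snd, WithLp.toLp_fst, WithLp.toLp_snd, add_sub_cancel_left,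
      norm_smul, Real.norm_of_nonneg hs.le]
    linarith
  have hin := hN (y := WithLp.toLp 2 (z.fst + s • ζ.fst, u))
    (by rw [dist_eq_norm]; exact hdist.trans_lt hsδ) hu
  have hin' : s * ‖ζ.fst‖ ^ 2 + inner ℝ ζ.snd (u - z.snd) ≤
      ε / (1 + κ) * ‖WithLp.toLp 2 (z.fst + s • ζ.fst, u) - z‖ := by
    have e : inner ℝ ζ.fst (z.fst + s • ζ.fst - z.fst) = s * ‖ζ.fst‖ ^ 2 := by
      rw [add_sub_cancel_left, real_inner_smul_right, real_inner_self_eq_norm_sq]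
    rw [← e]
    exact (inner_toLp_sub ζ.fst ζ.snd z
      (WithLp.toLp 2 (z.fst + s • ζ.fst, u))).symm.trans_le hin
  have hcs : -(‖ζ.snd‖ * (κ * (s * ‖ζ.fst‖))) ≤ inner ℝ ζ.snd (u - z.snd) := by
    have h1 := neg_le_of_abs_le (abs_real_inner_le_norm ζ.snd (u - z.snd))
    have h2 := mul_le_mul_of_nonneg_left hle (norm_nonneg ζ.snd)
    linarith
  have hrhs : ε / (1 + κ) * ‖WithLp.toLp 2 (z.fst + s • ζ.fst, u) - z‖ ≤ ε * (s * ‖ζ.fst‖) := by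
    calc _ ≤ ε / (1 + κ) * ((1 + κ) * (s * ‖ζ.fst‖)) := by gcongr
      _ = _ := by field_simp
  have hfinal : (s * ‖ζ.fst‖) * ‖ζ.fst‖ ≤ (s * ‖ζ.fst‖) * (κ * ‖ζ.snd‖ + ε) := by
    linarith
  exact le_of_mul_le_mul_left hfinal (by positivity)

/-- The coderivative of a Lipschitz-like mapping is trivial at the origin. -/
theorem LipschitzLikeRel.eq_zero_of_mem_coderivative {S : E → Set F} {x₀ : E} {u₀ : F}
    (h : LipschitzLikeRel S univ x₀ u₀) {t : E} (ht : t ∈ coderivative S x₀ u₀ 0) : t = 0 := by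
  obtain ⟨-, -, -, V, hV, W, hW, κ, hκ, hLip⟩ := h
  rw [coderivative, mem_ofPred_eq, neg_zero] at ht
  obtain ⟨-, z, ζ, hz, hζ, hlim⟩ := ht
  have hz := (tendsto_nhdsWithin_iff.1 hz).1
  have hz₁ : Tendsto (fun k => (z k).fst) atTop (𝓝 x₀) :=
    ((WithLp.continuous_fst 2 E F).tendsto _).comp hz
  have hz₂ : Tendsto (fun k => (z k).snd) atTop (𝓝 u₀) :=
    ((WithLp.continuous_snd 2 E F).tendsto _).comp hz
  have hζ₁ : Tendsto (fun k => ‖(ζ k).fst‖) atTop (𝓝 ‖t‖) :=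
    (((WithLp.continuous_fst 2 E F).tendsto _).comp hlim).norm
  have hζ₂ : Tendsto (fun k => κ * ‖(ζ k).snd‖) atTop (𝓝 (κ * ‖(0 : F)‖)) :=
    (((WithLp.continuous_snd 2 E F).tendsto _).comp hlim).norm.const_mul κ
  have hle : ‖t‖ ≤ κ * ‖(0 : F)‖ := by
    refine le_of_tendsto_of_tendsto hζ₁ hζ₂ ?_
    filter_upwards [hz₁.eventually (eventually_mem_nhds_iff.2 hV), hz₂.eventually hW] with k h₁ h₂
    exact norm_fst_le_of_mem_regularNormalCone hκ
      (fun y hy y' hy' => hLip y ⟨mem_univ _, hy⟩ y' ⟨mem_univ _, hy'⟩) h₁ h₂ (hζ k)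
  simpa using hle

end Lipschitz

/-! ### Persistence of full rank. -/

section SmoothManifold

variable {E G : Type*} [NormedAddCommGroup E] [NormedSpace ℝ E]
  [NormedAddCommGroup G] [NormedSpace ℝ G] [FiniteDimensional ℝ G]

/-- In finite dimensions, surjectivity of a continuous linear map is an open condition. -/
theorem eventually_surjective_of_surjective {L : E →L[ℝ] G} (hL : Function.Surjective L) :
    ∀ᶠ L' : E →L[ℝ] G in 𝓝 L, Function.Surjective L' := by
  have : CompleteSpace G := FiniteDimensional.complete ℝ G
  -- With `g` a right inverse of `L`, `L' ∘ g` stays invertible near `L` because units are open.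
  obtain ⟨g, hg⟩ := (L : E →ₗ[ℝ] G).exists_rightInverse_of_surjective (LinearMap.range_eq_top.2 hL)
  set g' : G →L[ℝ] E := LinearMap.toContinuousLinearMap g
  have hid : L ∘L g' = 1 := by
    ext x
    exact LinearMap.congr_fun hg x
  have hcont : Continuous fun L' : E →L[ℝ] G => L' ∘L g' := by fun_prop
  have hunit : ∀ᶠ A : G →L[ℝ] G in 𝓝 (L ∘L g'), IsUnit A :=
    Units.isOpen.mem_nhds (by rw [hid]; exact isUnit_one)
  filter_upwards [hcont.continuousAt.eventually hunit] with L' hL' y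
  obtain ⟨U, hU⟩ := hL'
  refine ⟨g' ((↑U⁻¹ : G →L[ℝ] G) y), ?_⟩
  have : (L' ∘L g') ((↑U⁻¹ : G →L[ℝ] G) y) = y := by
    rw [← hU]
    exact congrArg (fun A : G →L[ℝ] G => A y) U.mul_inv
  exact this

end SmoothManifold

/-! ### Tangent cones of regular level sets. -/

section TangentCone

variable {E G : Type*} [NormedAddCommGroup E] [InnerProductSpace ℝ E] [FiniteDimensional ℝ E]
  [NormedAddCommGroup G] [NormedSpace ℝ G] [FiniteDimensional ℝ G]

/-- The tangent cone to a regular level set is the kernel of the derivative. -/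
theorem tangentCone_eq_ker {X O : Set E} {f : E → G} (hO : IsOpen O)
    (hX : X ∩ O = {y ∈ O | f y = 0}) {x : E} (hxO : x ∈ O) (hxX : x ∈ X) {f' : E →L[ℝ] G}
    (hf : HasStrictFDerivAt f f' x) (hf' : Function.Surjective f') :
    tangentCone X x = {w | f' w = 0} := by
  have hmem : ∀ y ∈ O, (y ∈ X ↔ f y = 0) := fun y hy => by
    have := Set.ext_iff.1 hX y
    simpa [hy] using this
  have hfx : f x = 0 := (hmem x hxO).1 hxX
  ext w
  constructor
  · rintro ⟨-, t, d, ht, hd, hlim⟩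
    rw [tendsto_nhdsWithin_iff] at ht
    have htd : Tendsto (fun k => t k • d k) atTop (𝓝 0) := by simpa using ht.1.smul hlim
    have hc : Tendsto (fun k => (t k)⁻¹ • (t k • d k)) atTop (𝓝 w) := by
      refine hlim.congr' ?_
      filter_upwards [ht.2] with k hk
      rw [inv_smul_smul₀ (ne_of_gt hk)]
    have hder := hf.hasFDerivAt.hasFDerivWithinAt (s := univ) |>.lim htd (by simp) hc
    -- These quotients also tend to `f' w`, yet vanish eventually because `f = 0` on `X` near `x`.
    have h0 : Tendsto (fun k => (t k)⁻¹ • (f (x + t k • d k) - f x)) atTop (𝓝 0) := by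
      refine tendsto_const_nhds.congr' ?_
      have hOk : ∀ᶠ k in atTop, x + t k • d k ∈ O := by
        have : Tendsto (fun k => x + t k • d k) atTop (𝓝 x) := by
          simpa using tendsto_const_nhds.add htd
        exact this.eventually (hO.mem_nhds hxO)
      filter_upwards [hOk] with k hk
      rw [(hmem _ hk).1 (hd k), hfx, sub_zero, smul_zero]
    exact tendsto_nhds_unique hder h0
  · intro hw
    have hrange : (f' : E →ₗ[ℝ] G).range = ⊤ := LinearMap.range_eq_top.2 hf'
    have hcomplete : CompleteSpace E := FiniteDimensional.complete ℝ E
    -- The curve `γ (t • w')` lies in `X` for small `t` and has velocity `w` at zero.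
    set γ := hf.implicitFunction f f' hrange (f x) with hγ
    have hγ0 : γ 0 = x := hf.implicitFunction_apply_image hrange
    have hγ' : HasFDerivAt γ (LinearMap.ker (f' : E →ₗ[ℝ] G)).subtypeL 0 :=
      (hf.to_implicitFunction hrange).hasFDerivAt
    have hγf : ∀ᶠ y in 𝓝 (0 : LinearMap.ker (f' : E →ₗ[ℝ] G)), f (γ y) = 0 := by
      have h1 := hf.map_implicitFunction_eq hrange
      have hcont : Continuous fun y : LinearMap.ker (f' : E →ₗ[ℝ] G) => (f x, y) := by fun_prop
      filter_upwards [hcont.continuousAt.eventually h1] with y hy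
      exact hy.trans hfx
    have hγX : ∀ᶠ y in 𝓝 (0 : LinearMap.ker (f' : E →ₗ[ℝ] G)), γ y ∈ X := by
      filter_upwards [hγf, hγ'.continuousAt.eventually (hO.mem_nhds (hγ0.symm ▸ hxO))] with y hy hyO
      exact (hmem _ hyO).2 hy
    set w' : LinearMap.ker (f' : E →ₗ[ℝ] G) := ⟨w, hw⟩
    set t : ℕ → ℝ := fun k => 1 / ((k : ℝ) + 1) with ht
    have ht0 : Tendsto t atTop (𝓝 0) := tendsto_one_div_add_atTop_nhds_zero_nat
    have htpos : ∀ k, 0 < t k := fun k => Nat.one_div_pos_of_nat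
    have htw : Tendsto (fun k => t k • w') atTop (𝓝 0) := by
      simpa using ht0.smul_const w'
    have hder := (hγ'.hasFDerivWithinAt (s := univ)).lim (c := fun k => (t k)⁻¹)
      htw (by simp) (v := w')
      (tendsto_const_nhds.congr fun k => (inv_smul_smul₀ (htpos k).ne' w').symm)
    simp only [zero_add] at hder
    -- The shift by `N` is needed because membership in `X` holds only near zero, while the tangent
    -- sequence needs it for every index.
    obtain ⟨N, hN⟩ := eventually_atTop.1 (htw.eventually hγX)
    refine ⟨hxX, fun k => t (k + N), fun k => (t (k + N))⁻¹ • (γ (t (k + N) • w') - γ 0), ?_, ?_, ?_⟩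
    · exact tendsto_nhdsWithin_iff.2 ⟨(tendsto_add_atTop_iff_nat N).2 ht0,
        .of_forall fun k => htpos _⟩
    · intro k
      rw [mem_ofPred_eq, smul_inv_smul₀ (htpos _).ne', hγ0, add_sub_cancel]
      exact hN _ (Nat.le_add_left _ _)
    · exact (tendsto_add_atTop_iff_nat N).2 hder

end TangentCone

/-! ### Equality for graph-convex mappings over a manifold. -/

section ConvexManifold

/-- The projectional coderivative involves tangent cones at nearby points too; persistence of full
rank describes them all by one derivative map, continuous at `x₀`. -/
theorem IsSmoothManifoldAround.exists_ker {n d : ℕ} {X : Set (EuclideanSpace ℝ (Fin n))}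
    {x₀ : EuclideanSpace ℝ (Fin n)} (h : IsSmoothManifoldAround d X x₀) :
    ∃ L : EuclideanSpace ℝ (Fin n) → EuclideanSpace ℝ (Fin n) →L[ℝ] EuclideanSpace ℝ (Fin (n - d)),
      ContinuousAt L x₀ ∧ ∀ᶠ x in 𝓝 x₀, x ∈ X → tangentCone X x = {w | L x w = 0} := by
  obtain ⟨hx₀, -, O, hO, hxO, f, hf, hsurj, hX⟩ := h
  have hL : ContinuousAt (fderiv ℝ f) x₀ :=
    (hf.continuousOn_fderiv_of_isOpen hO le_rfl).continuousAt (hO.mem_nhds hxO)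
  refine ⟨fderiv ℝ f, hL, ?_⟩
  filter_upwards [hO.mem_nhds hxO, hL.eventually (eventually_surjective_of_surjective hsurj)]
    with x hxO' hxs hxX
  exact tangentCone_eq_ker hO hX hxO' hxX
    ((hf.contDiffAt (hO.mem_nhds hxO')).hasStrictFDerivAt one_ne_zero) hxs

variable {E F G : Type*} [NormedAddCommGroup E] [InnerProductSpace ℝ E]
  [NormedAddCommGroup F] [InnerProductSpace ℝ F] [NormedAddCommGroup G] [NormedSpace ℝ G]

theorem inner_sub_eq_zero_of_nearest {K : Submodule ℝ E} {t v : E} (ht : t ∈ K)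
    (hmin : ∀ s ∈ K, ‖t - v‖ ≤ ‖s - v‖) {s : E} (hs : s ∈ K) : inner ℝ (v - t) s = 0 := by
  refine (K.norm_eq_iInf_iff_real_inner_eq_zero ht).1 ?_ s hs
  refine le_antisymm (le_ciInf fun w => ?_) ?_
  · rw [norm_sub_rev, norm_sub_rev v]
    exact hmin w w.2
  · exact ciInf_le ⟨0, by rintro _ ⟨w, rfl⟩; exact norm_nonneg _⟩ (⟨t, ht⟩ : K)

/-- Over a smooth manifold, the projectional coderivative of a graph-convex mapping consists of the
tangent elements of its coderivative. -/
theorem mem_projCoderivative_iff_of_graphConvex {X : Set E} {S : E → Set F} {x₀ : E} {u₀ : F}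
    (hconv : GraphConvex (restrictMap S X)) (hu₀ : u₀ ∈ restrictMap S X x₀)
    {L : E → E →L[ℝ] G} (hL : ContinuousAt L x₀)
    (hker : ∀ᶠ x in 𝓝 x₀, x ∈ X → tangentCone X x = {w | L x w = 0}) {t : E} {u' : F} :
    t ∈ projCoderivative X S x₀ u₀ u' ↔ t ∈ tangentCone X x₀ ∧
      ∀ z ∈ gph (restrictMap S X), inner ℝ t (z.fst - x₀) - inner ℝ u' (z.snd - u₀) ≤ 0 := by
  have hmem₀ : WithLp.toLp 2 (x₀, u₀) ∈ gph (restrictMap S X) := hu₀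
  have hN : WithLp.toLp 2 (t, -u') ∈ normalCone (gph (restrictMap S X)) (WithLp.toLp 2 (x₀, u₀)) ↔
      ∀ z ∈ gph (restrictMap S X), inner ℝ t (z.fst - x₀) - inner ℝ u' (z.snd - u₀) ≤ 0 := by
    rw [mem_normalCone_iff_of_convex hconv hmem₀]
    refine forall₂_congr fun z _ => ?_
    rw [inner_toLp_sub, inner_neg_left, ← sub_eq_add_neg]
    rfl
  rw [← hN]
  constructor
  · rintro ⟨z, ζ, hz, hζ, hlim⟩
    rw [tendsto_nhdsWithin_iff] at hz
    have hz₁ : Tendsto (fun k => (z k).fst) atTop (𝓝 x₀) :=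
      ((WithLp.continuous_fst 2 E F).tendsto _).comp hz.1
    have hζ₁ : Tendsto (fun k => (ζ k).fst) atTop (𝓝 t) :=
      ((WithLp.continuous_fst 2 E F).tendsto _).comp hlim
    have hgood : ∀ᶠ k in atTop, L (z k).fst (ζ k).fst = 0 ∧
        ∀ y ∈ gph (restrictMap S X), inner ℝ (ζ k) (y - z k) ≤ 0 := by
      filter_upwards [hz₁.eventually hker, hz.2] with k hk hzk
      obtain ⟨v, hv, ht, hmin⟩ :=
        mem_projSet_fst_iff.1 (show WithLp.toLp 2 ((ζ k).fst, (ζ k).snd) ∈ _ from hζ k)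
      have hTk := hk hzk.1
      refine ⟨by rwa [hTk] at ht, fun y hy => ?_⟩
      -- Graph convexity puts the segment from `z k` to `y` in the graph, so its base stays in `X`.
      have hdir : y.fst - (z k).fst ∈ tangentCone X (z k).fst := by
        refine ⟨hzk.1, fun j => 1 / ((j : ℝ) + 1), fun _ => y.fst - (z k).fst, ?_, fun j => ?_,
          tendsto_const_nhds⟩
        · exact tendsto_nhdsWithin_iff.2 ⟨tendsto_one_div_add_atTop_nhds_zero_nat,
            .of_forall fun j => mem_Ioi.2 (Nat.one_div_pos_of_nat (n := j))⟩
        · have := hconv.add_smul_sub_mem hzk hy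
            (t := 1 / ((j : ℝ) + 1)) ⟨by positivity, by
              rw [div_le_one (by positivity)]
              linarith [(Nat.cast_nonneg j : (0 : ℝ) ≤ j)]⟩
          exact this.1
      set K : Submodule ℝ E := LinearMap.ker (L (z k).fst : E →ₗ[ℝ] G) with hK
      have hTK : ∀ s, s ∈ K ↔ s ∈ tangentCone X (z k).fst := fun s => by rw [hTk]; rfl
      -- The residual of the projection is orthogonal to this direction, so replacing `v` by its
      -- projection does not affect the normal inequality.
      have horth := inner_sub_eq_zero_of_nearest (K := K) ((hTK _).2 ht)
        (fun s hs => hmin s ((hTK s).1 hs)) ((hTK _).2 hdir)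
      have hvy := (mem_normalCone_iff_of_convex hconv hzk).1 hv y hy
      rw [inner_toLp_sub] at hvy
      rw [inner_sub_left, sub_eq_zero] at horth
      rw [show ζ k = WithLp.toLp 2 ((ζ k).fst, (ζ k).snd) from rfl, inner_toLp_sub, ← horth]
      exact hvy
    constructor
    · rw [hker.self_of_nhds hu₀.1]
      have h1 : Tendsto (fun k => L (z k).fst (ζ k).fst) atTop (𝓝 (L x₀ t)) :=
        (isBoundedBilinearMap_apply.continuous.tendsto (L x₀, t)).comp
          ((hL.tendsto.comp hz₁).prodMk_nhds hζ₁)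
      exact tendsto_nhds_unique h1
        (tendsto_const_nhds.congr' (hgood.mono fun k hk => hk.1.symm))
    · refine (mem_normalCone_iff_of_convex hconv hmem₀).2 fun y hy => ?_
      exact le_of_tendsto (hlim.inner (tendsto_const_nhds.sub hz.1))
        (hgood.mono fun k hk => hk.2 y hy)
  · rintro ⟨ht, hn⟩
    -- A tangent normal is its own projection, so constant sequences suffice.
    exact subset_outerLimit_nhdsWithin (fun z : WithLp 2 (E × F) => projSet
      {y : WithLp 2 (E × F) | y.fst ∈ tangentCone X z.fst} (normalCone (gph (restrictMap S X)) z))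
      hmem₀ (mem_projSet_fst_of_mem ht hn)

theorem mem_coderivative_iff_of_graphConvex {S : E → Set F} {x₀ : E} {u₀ : F}
    (hconv : GraphConvex S) (hu₀ : u₀ ∈ S x₀) {t : E} {u' : F} :
    t ∈ coderivative S x₀ u₀ u' ↔
      ∀ z ∈ gph S, inner ℝ t (z.fst - x₀) - inner ℝ u' (z.snd - u₀) ≤ 0 := by
  rw [coderivative, mem_ofPred_eq, mem_normalCone_iff_of_convex hconv
    (show WithLp.toLp 2 (x₀, u₀) ∈ gph S from hu₀)]
  refine forall₂_congr fun z _ => ?_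
  rw [inner_toLp_sub, inner_neg_left, ← sub_eq_add_neg]
  rfl

variable {P : Type*} [NormedAddCommGroup P] [InnerProductSpace ℝ P]

/-- Intermediate points may be combined with the same weights as the endpoints. -/
theorem graphConvex_compMap {T : E → Set P} {S : P → Set F} (hT : GraphConvex T)
    (hS : GraphConvex S) : GraphConvex (compMap S T) := by
  intro z hz z' hz' a b ha hb hab
  obtain ⟨w, hw, hu⟩ := mem_iUnion₂.1 hz
  obtain ⟨w', hw', hu'⟩ := mem_iUnion₂.1 hz'
  refine mem_iUnion₂.2 ⟨a • w + b • w', ?_, ?_⟩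
  · exact hT (show WithLp.toLp 2 (z.fst, w) ∈ gph T from hw)
      (show WithLp.toLp 2 (z'.fst, w') ∈ gph T from hw') ha hb hab
  · exact hS (show WithLp.toLp 2 (w, z.snd) ∈ gph S from hu)
      (show WithLp.toLp 2 (w', z'.snd) ∈ gph S from hu') ha hb hab

/-- For graph-convex mappings over a smooth manifold, the chain rule inclusion is an equality at
every intermediate point. -/
theorem projCoderivative_compMap_eq_of_graphConvex {X : Set E} {S₁ : E → Set P} {S₂ : P → Set F}
    {x₀ : E} {u₀ : F} (h₁ : GraphConvex (restrictMap S₁ X)) (h₂ : GraphConvex S₂)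
    {L : E → E →L[ℝ] G} (hL : ContinuousAt L x₀)
    (hker : ∀ᶠ x in 𝓝 x₀, x ∈ X → tangentCone X x = {w | L x w = 0})
    (hsub : ∀ u', projCoderivative X (compMap S₂ S₁) x₀ u₀ u' ⊆
      ⋃ w₀ ∈ restrictMap S₁ X x₀ ∩ invMap S₂ u₀,
        compMap (projCoderivative X S₁ x₀ w₀) (coderivative S₂ w₀ u₀) u')
    {w₀ : P} (hw₀ : w₀ ∈ restrictMap S₁ X x₀ ∩ invMap S₂ u₀) :
    projCoderivative X (compMap S₂ S₁) x₀ u₀ =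
      compMap (projCoderivative X S₁ x₀ w₀) (coderivative S₂ w₀ u₀) := by
  have hconv : GraphConvex (restrictMap (compMap S₂ S₁) X) := by
    rw [restrictMap_compMap]
    exact graphConvex_compMap h₁ h₂
  have hu₀ : u₀ ∈ restrictMap (compMap S₂ S₁) X x₀ := by
    rw [restrictMap_compMap]
    exact mem_biUnion hw₀.1 hw₀.2
  funext u'
  refine Subset.antisymm (fun t ht => ?_) (fun t ht => ?_)
  · obtain ⟨w, hw, ht⟩ := mem_iUnion₂.1 (hsub u' ht)
    obtain ⟨q, hq, ht⟩ := mem_iUnion₂.1 ht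
    refine mem_biUnion (x := q) ?_ ?_
    all_goals
      rw [mem_coderivative_iff_of_graphConvex h₂ hw.2] at hq
      rw [mem_projCoderivative_iff_of_graphConvex h₁ hw.1 hL hker] at ht
      -- Testing both normals at `w₀` gives opposite signs for `⟪q, w₀ - w⟫`. It therefore vanishes,
      -- and `w` may be replaced by `w₀`.
      have e₁ := hq (WithLp.toLp 2 (w₀, u₀)) hw₀.2
      have e₂ := ht.2 (WithLp.toLp 2 (x₀, w₀)) hw₀.1
      simp only [WithLp.toLp_fst, WithLp.toLp_snd, sub_self, inner_zero_right, sub_zero, zero_sub,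
        neg_nonpos] at e₁ e₂
      have e : ∀ p : P, inner ℝ q (p - w₀) = inner ℝ q (p - w) := fun p => by
        rw [← sub_add_sub_cancel p w₀ w, inner_add_right, le_antisymm e₁ e₂, add_zero]
    · rw [mem_coderivative_iff_of_graphConvex h₂ hw₀.2]
      intro z hz
      rw [e]
      exact hq z hz
    · rw [mem_projCoderivative_iff_of_graphConvex h₁ hw₀.1 hL hker]
      refine ⟨ht.1, fun z hz => ?_⟩
      rw [e]
      exact ht.2 z hz
  · obtain ⟨q, hq, ht⟩ := mem_iUnion₂.1 ht
    rw [mem_coderivative_iff_of_graphConvex h₂ hw₀.2] at hq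
    rw [mem_projCoderivative_iff_of_graphConvex h₁ hw₀.1 hL hker] at ht
    rw [mem_projCoderivative_iff_of_graphConvex hconv hu₀ hL hker]
    refine ⟨ht.1, fun z hz => ?_⟩
    rw [restrictMap_compMap] at hz
    obtain ⟨w, hw, hu⟩ := mem_iUnion₂.1 hz
    -- In the sum of these two inequalities the `q` terms cancel.
    have e₁ := hq (WithLp.toLp 2 (w, z.snd)) hu
    have e₂ := ht.2 (WithLp.toLp 2 (z.fst, w)) hw
    simp only [WithLp.toLp_fst, WithLp.toLp_snd] at e₁ e₂
    linarith

end ConvexManifold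

end ProjCoderiv

theorem theorem5p1 (n p m : ℕ)
    (S₁ : EuclideanSpace ℝ (Fin n) → Set (EuclideanSpace ℝ (Fin p)))
    (S₂ : EuclideanSpace ℝ (Fin p) → Set (EuclideanSpace ℝ (Fin m)))
    (S : EuclideanSpace ℝ (Fin n) → Set (EuclideanSpace ℝ (Fin m)))
    (hS : S = compMap S₂ S₁)
    (X : Set (EuclideanSpace ℝ (Fin n))) (hX : IsClosed X)
    (hS₁ : OuterSemicontinuousRel S₁ X)
    (hS₂ : OuterSemicontinuousRel S₂ univ)
    (x₀ : EuclideanSpace ℝ (Fin n)) (hx₀ : x₀ ∈ X)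
    (u₀ : EuclideanSpace ℝ (Fin m)) (hu₀ : u₀ ∈ S x₀) :
    -- the chain rule, under the local boundedness (a) and the qualification condition (b)
    (LocallyBoundedRel
        (fun z : EuclideanSpace ℝ (Fin n) × EuclideanSpace ℝ (Fin m) =>
          restrictMap S₁ X z.1 ∩ invMap S₂ z.2) univ (x₀, u₀) →
      (∀ w₀ ∈ restrictMap S₁ X x₀ ∩ invMap S₂ u₀,
        coderivative S₂ w₀ u₀ 0 ∩ invMap (projCoderivative X S₁ x₀ w₀) 0 = {0}) →
      LocallyClosedAt (gph (restrictMap S X)) (WithLp.toLp 2 (x₀, u₀)) ∧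
      (∀ u', projCoderivative X S x₀ u₀ u' ⊆
        ⋃ w₀ ∈ restrictMap S₁ X x₀ ∩ invMap S₂ u₀,
          compMap (projCoderivative X S₁ x₀ w₀) (coderivative S₂ w₀ u₀) u') ∧
      (GraphConvex (restrictMap S₁ X) → GraphConvex S₂ →
        (∃ d : ℕ, IsSmoothManifoldAround d X x₀) →
        GraphConvex (restrictMap S X) ∧
        ∀ w₀ ∈ restrictMap S₁ X x₀ ∩ invMap S₂ u₀,
          projCoderivative X S x₀ u₀ =
            compMap (projCoderivative X S₁ x₀ w₀) (coderivative S₂ w₀ u₀))) ∧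
    -- the equivalent form of (a)
    (LocallyBoundedRel
        (fun z : EuclideanSpace ℝ (Fin n) × EuclideanSpace ℝ (Fin m) =>
          restrictMap S₁ X z.1 ∩ invMap S₂ z.2) univ (x₀, u₀) ↔
      LocallyBoundedRel
        (fun z : EuclideanSpace ℝ (Fin n) × EuclideanSpace ℝ (Fin m) =>
          S₁ z.1 ∩ invMap S₂ z.2) (X ×ˢ univ) (x₀, u₀)) ∧
    -- sufficient conditions for (a)
    (LocallyBoundedRel S₁ X x₀ ∨ LocallyBoundedRel (invMap S₂) univ u₀ →
      LocallyBoundedRel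
        (fun z : EuclideanSpace ℝ (Fin n) × EuclideanSpace ℝ (Fin m) =>
          restrictMap S₁ X z.1 ∩ invMap S₂ z.2) univ (x₀, u₀)) ∧
    -- outer semicontinuity of the composition when (a) holds at every pair `(x₀, u)`
    ((∀ u : EuclideanSpace ℝ (Fin m), LocallyBoundedRel
        (fun z : EuclideanSpace ℝ (Fin n) × EuclideanSpace ℝ (Fin m) =>
          restrictMap S₁ X z.1 ∩ invMap S₂ z.2) univ (x₀, u)) →
      OuterSemicontinuousAtRel (compMap S₂ (restrictMap S₁ X)) univ x₀) ∧
    -- a sufficient condition for the qualification condition in (b) at a given `w₀`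
    (∀ w₀ ∈ restrictMap S₁ X x₀ ∩ invMap S₂ u₀, LipschitzLikeRel S₂ univ w₀ u₀ →
      coderivative S₂ w₀ u₀ 0 ∩ invMap (projCoderivative X S₁ x₀ w₀) 0 = {0}) := by
  subst hS
  have hT := isClosed_gph_restrictMap hX hS₁
  have hS := isClosed_gph hS₂
  refine ⟨fun ha hb => ?_, locallyBoundedRel_restrict_iff, ?_,
    outerSemicontinuousAtRel_compMap hT hS, fun w₀ hw₀ hLip => ?_⟩
  · obtain ⟨r, R, hr, hR⟩ := ha.exists_bound
    have hsub := projCoderivative_compMap_subset hT hS hr hR hb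
    refine ⟨?_, hsub, fun h₁ h₂ hman => ?_⟩
    · rw [restrictMap_compMap]
      exact locallyClosedAt_gph_compMap hT hS hr hR
    · obtain ⟨d, hd⟩ := hman
      obtain ⟨L, hL, hker⟩ := hd.exists_ker
      refine ⟨?_, fun w₀ hw₀ =>
        projCoderivative_compMap_eq_of_graphConvex h₁ h₂ hL hker hsub hw₀⟩
      rw [restrictMap_compMap]
      exact graphConvex_compMap h₁ h₂
  · rintro (h | h)
    · exact locallyBoundedRel_of_left h
    · exact locallyBoundedRel_of_right h
  -- The coderivative factor alone is already trivial.
  · refine Subset.antisymm (fun t ht => hLip.eq_zero_of_mem_coderivative ht.1) ?_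
    rintro _ rfl
    exact ⟨zero_mem_coderivative hw₀.2, zero_mem_projCoderivative hw₀.1⟩
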